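/- Let $(\Sigma,h)$ be a smooth ($C^\infty$), connected, Hausdorff, second countable, finite-dimensional Riemannian manifold without boundary, with Riemannian distance $d^h$. A geodesic segment is a $C^2$ curve $\gamma:[a,b]\to\Sigma$, $a<b$, satisfying the geodesic equation of the Levi-Civita connection of $h$ (constant curves allowed); it is called a minimizing geodesic if its length equals $d^h(\gamma(a),\gamma(b))$. Consider the following properties. (i) $\Sigma$ is convex: any two points of $\Sigma$ are joined by a minimizing geodesic. (ii) $\Sigma$ satisfies the minimal limit geodesic segment property (minimal LGS): whenever $p_k\to p$ and $q_k\to q\neq p$ in $\Sigma$ and, for each $k\in\mathbb N$, $\sigma_k:[a_k,b_k]\to\Sigma$ is a minimizing geodesic from $p_k$ to $q_k$, some subsequence of the $\sigma_k$, affinely reparametrized on $[0,1]$, converges uniformly on $[0,1]$ to a minimizing geodesic $\sigma:[0,1]\to\Sigma$ from $p$ to $q$. (iii) $\Sigma$ is minimally pseudoconvex: for every compact set $C\subseteq\Sigma$ there is a compact set $C'\subseteq\Sigma$ such that every minimizing geodesic with both endpoints in $C$ is entirely contained in $C'$. If $\Sigma$ is convex, then it satisfies the minimal LGS and is minimally pseudoconvex.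 Moreover, for every such $\Sigma$ (convex or not), the minimal LGS holds if and only if $\Sigma$ is minimally pseudoconvex. -/

import Mathlib

open Set Filter Topology Bundle
open scoped Manifold ContDiff

noncomputable section

namespace RiemannianConvexity

section Geodesics

variable (n : ℕ) {M : Type*} [EMetricSpace M] [ChartedSpace (EuclideanSpace ℝ (Fin n)) M]
  [RiemannianBundle (fun x : M ↦ TangentSpace (𝓡 n) x)]

/-- The Riemannian metric read in the chart around `x₀`: the value at the point `y` of the chart
and at the coordinate vectors `v`, `w`. In coordinates, `∑ i j, g_ij(y) vⁱ wʲ`. -/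
def chartMetric (x₀ : M) (y v w : EuclideanSpace ℝ (Fin n)) : ℝ :=
  inner ℝ
    (mfderiv 𝓘(ℝ, EuclideanSpace ℝ (Fin n)) (𝓡 n) (extChartAt (𝓡 n) x₀).symm y v :
      TangentSpace (𝓡 n) ((extChartAt (𝓡 n) x₀).symm y))
    (mfderiv 𝓘(ℝ, EuclideanSpace ℝ (Fin n)) (𝓡 n) (extChartAt (𝓡 n) x₀).symm y w :
      TangentSpace (𝓡 n) ((extChartAt (𝓡 n) x₀).symm y))

/-- Christoffel symbols of the first kind of the Levi-Civita connection in the chart around `x₀`: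
`Γ(y)(v, w; z) = ½ (∂_v g(w, z) + ∂_w g(v, z) - ∂_z g(v, w))`, which is `g(∇_v w, z)` for the
constant coordinate vector fields `v`, `w`, `z`. -/
def christoffel (x₀ : M) (y v w z : EuclideanSpace ℝ (Fin n)) : ℝ :=
  (1 / 2 : ℝ) *
    (fderiv ℝ (fun y' ↦ chartMetric n x₀ y' w z) y v
      + fderiv ℝ (fun y' ↦ chartMetric n x₀ y' v z) y w
      - fderiv ℝ (fun y' ↦ chartMetric n x₀ y' v w) y z)

/-- `γ` restricted to `[a, b]`, `a < b`, is a geodesic segment: in every chart, the coordinate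
expression `u` of `γ` satisfies the geodesic equation `u'' + Γ(u)(u', u') = 0`, here paired through
the metric with an arbitrary coordinate vector `z`. Derivatives at `a` and `b` are one-sided.
The values of `γ` outside `[a, b]` play no role. -/
structure IsGeodesicSegment (γ : ℝ → M) (a b : ℝ) : Prop where
  lt : a < b
  contMDiffOn : ContMDiffOn 𝓘(ℝ, ℝ) (𝓡 n) 2 γ (Icc a b)
  geodesic_eq : ∀ (x₀ : M), ∀ t ∈ Icc a b, γ t ∈ (extChartAt (𝓡 n) x₀).source →
    ∀ z : EuclideanSpace ℝ (Fin n),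
      chartMetric n x₀ (extChartAt (𝓡 n) x₀ (γ t))
          (derivWithin (derivWithin (extChartAt (𝓡 n) x₀ ∘ γ) (Icc a b)) (Icc a b) t) z
        + christoffel n x₀ (extChartAt (𝓡 n) x₀ (γ t))
          (derivWithin (extChartAt (𝓡 n) x₀ ∘ γ) (Icc a b) t)
          (derivWithin (extChartAt (𝓡 n) x₀ ∘ γ) (Icc a b) t) z = 0

/-- A minimizing geodesic: a geodesic segment whose length is the distance of its endpoints. -/
structure IsMinimizingGeodesic (γ : ℝ → M) (a b : ℝ) : Prop where
  isGeodesicSegment : IsGeodesicSegment n γ a b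
  length_eq : Manifold.pathELength (𝓡 n) γ a b = edist (γ a) (γ b)

variable (M)

/-- Any two points are joined by a minimizing geodesic. -/
def IsConvexManifold : Prop :=
  ∀ p q : M, ∃ (a b : ℝ) (γ : ℝ → M), IsMinimizingGeodesic n γ a b ∧ γ a = p ∧ γ b = q

/-- For every compact `C` there is a compact `C'` containing every minimizing geodesic with
endpoints in `C`. -/
def IsMinimallyPseudoconvex : Prop :=
  ∀ C : Set M, IsCompact C → ∃ C' : Set M, IsCompact C' ∧
    ∀ (a b : ℝ) (γ : ℝ → M), IsMinimizingGeodesic n γ a b → γ a ∈ C → γ b ∈ C →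
      γ '' Icc a b ⊆ C'

/-- The minimal limit geodesic segment property. If minimizing geodesics `σ k` on `[a k, b k]` have
initial points converging to `p` and final points converging to `q ≠ p`, then a subsequence,
affinely reparametrized on `[0, 1]`, converges uniformly to a minimizing geodesic from `p` to `q`.
(On the compact interval `[0, 1]`, uniform and locally uniform convergence agree.) -/
def HasMinimalLGS : Prop :=
  ∀ (p q : M) (a b : ℕ → ℝ) (σ : ℕ → ℝ → M), q ≠ p →
    (∀ k, IsMinimizingGeodesic n (σ k) (a k) (b k)) →
    Tendsto (fun k ↦ σ k (a k)) atTop (𝓝 p) →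
    Tendsto (fun k ↦ σ k (b k)) atTop (𝓝 q) →
    ∃ (φ : ℕ → ℕ) (τ : ℝ → M), StrictMono φ ∧
      IsMinimizingGeodesic n τ 0 1 ∧ τ 0 = p ∧ τ 1 = q ∧
      TendstoUniformlyOn (fun k t ↦ σ (φ k) (AffineMap.lineMap (a (φ k)) (b (φ k)) t)) τ
        atTop (Icc 0 1)

end Geodesics

end RiemannianConvexity

end

/-!
Read in a chart, a geodesic segment is the position of an integral curve of the geodesic spray, a
`C¹` vector field on pairs (position, velocity) (`IsGeodesicSegment.hasDerivWithinAt_chartState`,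
`isGeodesicSegment_of_eventually`). Geodesics have constant speed, so a minimizing geodesic `γ` of
speed `v` satisfies `edist (γ s) (γ t) = v * |t - s|` (`IsMinimizingGeodesic.edist_eq`).

*Limits.* A pointwise limit of minimizing geodesics is a minimizing geodesic
(`IsMinimizingGeodesic.of_tendsto`). Near a point of the limit curve, all the geodesics stay in one
chart and their states stay in a compact set, on which the spray is bounded and Lipschitz. Along an
ultrafilter the states converge, and since their first-order Taylor formulas hold with a uniform
quadratic error, the limit is again an integral curve. Distances, speeds and hence lengths pass to
the limit. As minimizing geodesics of bounded speed are equi-Lipschitz, the convergence is moreover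
uniform (`IsMinimizingGeodesic.tendstoUniformlyOn`).

*Limit segments and pseudoconvexity.* If the geodesics stay in a compact set, they converge
pointwise along an ultrafilter on `ℕ`, hence uniformly, and a subsequence of the original sequence
can be extracted: pseudoconvexity implies the minimal limit geodesic segment property. Conversely,
given a sequence of points on minimizing geodesics with endpoints in a compact set `C`, one may
assume that the endpoints converge. If their limits differ, the limit segment property yields a
cluster point; if they agree, the geodesics shrink to a point. So the union of all such geodesics
has compact closure.

*Convex manifolds.* Here pseudoconvexity holds because minimizing geodesics `σ i` on `[0, 1]` with
endpoints converging to `p` and `q` always converge pointwise along an ultrafilter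
(`IsConvexManifold.exists_tendsto`). By local compactness they converge on some `[0, ε]`. Let `c` be
a minimizing geodesic from the limit at time `ε` to `q`, parametrized on `[ε, 1]`. If `σ i`
converges to `c` at time `s`, it converges near `s` to a minimizing geodesic `τ`, and the triangle
inequality shows that `τ` up to time `s` followed by `c` still realizes the distance near the
junction. A concatenation of this kind has no corner (`chartState_eq_of_edist_ge`), so `τ = c`
shortly after `s` by uniqueness for ordinary differential equations
(`eventually_eq_of_chartState_eq`). Continuous induction on `[ε, 1]` finishes the argument.
-/

namespace RiemannianConvexity

set_option maxSynthPendingDepth 3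

noncomputable section

section

/-! ### The geodesic equation of a field of bilinear forms -/

section Abstract

variable {E : Type*} [NormedAddCommGroup E] [NormedSpace ℝ E]

/-- The tensor of Christoffel symbols of the first kind of the metric `G`, contracted twice
with `v`, as a linear form. -/
def christoffelForm (G : E → E →L[ℝ] E →L[ℝ] ℝ) (y v : E) : E →L[ℝ] ℝ :=
  fderiv ℝ G y v v - (1 / 2 : ℝ) • ((fderiv ℝ G y).flip v).flip v

/-- The right-hand side of the geodesic equation `u'' = geodesicAccel G (u, u')` of the
metric `G`. (The value is `0` where `G` is degenerate, as `inverse` is.) -/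
def geodesicAccel (G : E → E →L[ℝ] E →L[ℝ] ℝ) (p : E × E) : E :=
  -(G p.1).inverse (christoffelForm G p.1 p.2)

lemma geodesicAccel_smul (G : E → E →L[ℝ] E →L[ℝ] ℝ) (y v : E) (m : ℝ) :
    geodesicAccel G (y, m • v) = m ^ 2 • geodesicAccel G (y, v) := by
  have : christoffelForm G y (m • v) = m ^ 2 • christoffelForm G y v := by
    ext z; simp [christoffelForm]; ring
  simp [geodesicAccel, this]

lemma apply_geodesicAccel {G : E → E →L[ℝ] E →L[ℝ] ℝ} {y : E} (hG : (G y).IsInvertible) (v : E) :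
    G y (geodesicAccel G (y, v)) = -christoffelForm G y v := by
  simp only [geodesicAccel, map_neg]
  rw [hG.self_apply_inverse]

lemma contDiffAt_geodesicAccel [CompleteSpace E] {G : E → E →L[ℝ] E →L[ℝ] ℝ} {p : E × E}
    (hG : ContDiffAt ℝ 2 G p.1) (hi : (G p.1).IsInvertible) :
    ContDiffAt ℝ 1 (geodesicAccel G) p := by
  have h1 : ContDiffAt ℝ 1 (fun p : E × E ↦ G p.1) p :=
    (hG.of_le one_le_two).comp p contDiffAt_fst
  have h2 : ContDiffAt ℝ 1 (fun p : E × E ↦ fderiv ℝ G p.1) p :=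
    (hG.fderiv_right (m := 1) (by norm_num)).comp p contDiffAt_fst
  have h3 : ContDiffAt ℝ 1 (fun p : E × E ↦ (G p.1).inverse) p := by
    obtain ⟨e, he⟩ := hi
    have := contDiffAt_map_inverse (𝕜 := ℝ) (n := 1) e
    rw [he] at this
    exact this.comp p h1
  have hs : ContDiffAt ℝ 1 (fun p : E × E ↦ p.2) p := contDiffAt_snd
  have fl := (ContinuousLinearMap.flipₗᵢ ℝ E E (E →L[ℝ] ℝ)).toContinuousLinearEquiv.contDiff
    (n := 1)
  have fl' := (ContinuousLinearMap.flipₗᵢ ℝ E E ℝ).toContinuousLinearEquiv.contDiff (n := 1)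
  have h4 : ContDiffAt ℝ 1 (fun p : E × E ↦ ((fderiv ℝ G p.1).flip p.2).flip p.2) p :=
    (fl'.contDiffAt.comp p ((fl.contDiffAt.comp p h2).clm_apply hs)).clm_apply hs
  have h5 : ContDiffAt ℝ 1 (fun p : E × E ↦ christoffelForm G p.1 p.2) p :=
    ((h2.clm_apply hs).clm_apply hs).sub (h4.const_smul (1 / 2 : ℝ))
  exact (h3.clm_apply h5).neg

/-- A geodesic has constant speed: the derivative of `G u u' u'` along a solution vanishes. -/
lemma hasDerivWithinAt_apply_self_of_geodesicAccel {G : E → E →L[ℝ] E →L[ℝ] ℝ} {u w : ℝ → E}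
    {s : Set ℝ} {t : ℝ} (hG : DifferentiableAt ℝ G (u t)) (hi : (G (u t)).IsInvertible)
    (hsymm : ∀ v w, G (u t) v w = G (u t) w v) (hu : HasDerivWithinAt u (w t) s t)
    (hw : HasDerivWithinAt w (geodesicAccel G (u t, w t)) s t) :
    HasDerivWithinAt (fun t ↦ G (u t) (w t) (w t)) 0 s t := by
  have h := ((hG.hasFDerivAt.comp_hasDerivWithinAt t hu).clm_apply hw).clm_apply hw
  convert! h using 1
  have e := congrArg (· (w t)) (apply_geodesicAccel hi (w t))
  simp only [neg_apply] at e
  simp [hsymm (w t), e, christoffelForm]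
  ring

end Abstract

variable {n : ℕ} {M : Type*} [EMetricSpace M] [ChartedSpace (EuclideanSpace ℝ (Fin n)) M]
  [RiemannianBundle (fun x : M ↦ TangentSpace (𝓡 n) x)]

/-! ### The metric in a chart -/

lemma chartMetric_comm (x₀ : M) (y v w : EuclideanSpace ℝ (Fin n)) :
    chartMetric n x₀ y v w = chartMetric n x₀ y w v :=
  real_inner_comm _ _

lemma isBilinearMap_chartMetric (x₀ : M) (y : EuclideanSpace ℝ (Fin n)) :
    IsBilinearMap ℝ (chartMetric n x₀ y) := by
  have add (u v w) : chartMetric n x₀ y (u + v) w =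
      chartMetric n x₀ y u w + chartMetric n x₀ y v w :=
    (congrArg (inner ℝ · _) (map_add (mfderiv 𝓘(ℝ, EuclideanSpace ℝ (Fin n)) (𝓡 n)
      (extChartAt (𝓡 n) x₀).symm y) u v)).trans (inner_add_left _ _ _)
  have smul (c : ℝ) (v w) : chartMetric n x₀ y (c • v) w = c • chartMetric n x₀ y v w :=
    (congrArg (inner ℝ · _) (map_smul (mfderiv 𝓘(ℝ, EuclideanSpace ℝ (Fin n)) (𝓡 n)
      (extChartAt (𝓡 n) x₀).symm y) c v)).trans (real_inner_smul_left _ _ _)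
  refine ⟨add, smul, fun u v w ↦ ?_, fun c v w ↦ ?_⟩
  · simp only [chartMetric_comm x₀ y u, add]
  · simp only [chartMetric_comm x₀ y v, smul]

/-- The metric in the chart around `x₀`, as a continuous bilinear form depending on the point of
the chart. -/
def gram (x₀ : M) (y : EuclideanSpace ℝ (Fin n)) :
    EuclideanSpace ℝ (Fin n) →L[ℝ] EuclideanSpace ℝ (Fin n) →L[ℝ] ℝ :=
  (isBilinearMap_chartMetric x₀ y).toContinuousBilinearMap

@[simp] lemma gram_apply (x₀ : M) (y v w : EuclideanSpace ℝ (Fin n)) :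
    gram x₀ y v w = chartMetric n x₀ y v w := rfl

lemma gram_symm (x₀ : M) (y v w : EuclideanSpace ℝ (Fin n)) :
    gram x₀ y v w = gram x₀ y w v := chartMetric_comm x₀ y v w

lemma gram_self_nonneg (x₀ : M) (y v : EuclideanSpace ℝ (Fin n)) : 0 ≤ gram x₀ y v v := by
  simp only [gram_apply, chartMetric]; exact real_inner_self_nonneg

variable [IsManifold (𝓡 n) ∞ M]

lemma gram_self_pos (x₀ : M) {y : EuclideanSpace ℝ (Fin n)}
    (hy : y ∈ (extChartAt (𝓡 n) x₀).target) {v : EuclideanSpace ℝ (Fin n)} (hv : v ≠ 0) :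
    0 < gram x₀ y v v := by
  simp only [gram_apply, chartMetric]
  refine real_inner_self_pos.2 fun h ↦ hv ?_
  have h1 := isInvertible_mfderivWithin_extChartAt_symm (I := 𝓡 n) hy
  rw [ModelWithCorners.Boundaryless.range_eq_univ, mfderivWithin_univ] at h1
  exact h1.injective (h.trans (map_zero _).symm)

lemma gram_injective (x₀ : M) {y : EuclideanSpace ℝ (Fin n)}
    (hy : y ∈ (extChartAt (𝓡 n) x₀).target) : Function.Injective (gram x₀ y) := by
  refine (injective_iff_map_eq_zero _).2 fun v hv ↦ ?_
  by_contra h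
  exact (gram_self_pos x₀ hy h).ne' (by rw [hv]; rfl)

lemma isInvertible_gram (x₀ : M) {y : EuclideanSpace ℝ (Fin n)}
    (hy : y ∈ (extChartAt (𝓡 n) x₀).target) : (gram x₀ y).IsInvertible := by
  have hd : Module.finrank ℝ (EuclideanSpace ℝ (Fin n)) =
      Module.finrank ℝ (EuclideanSpace ℝ (Fin n) →L[ℝ] ℝ) := by
    rw [← LinearMap.toContinuousLinearMap.finrank_eq, Subspace.dual_finrank_eq]
  exact ⟨(LinearEquiv.ofInjectiveOfFinrankEq _ (gram_injective x₀ hy) hd).toContinuousLinearEquiv,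
    by ext; rfl⟩

variable [IsContMDiffRiemannianBundle (𝓡 n) ∞ (EuclideanSpace ℝ (Fin n))
      (fun x : M ↦ TangentSpace (𝓡 n) x)]

lemma contDiffOn_gram (x₀ : M) : ContDiffOn ℝ ∞ (gram x₀) (extChartAt (𝓡 n) x₀).target := by
  refine contDiffOn_clm_apply.2 fun v ↦ contDiffOn_clm_apply.2 fun w ↦ ?_
  have hT := isOpen_extChartAt_target (I := 𝓡 n) x₀
  have key (v : EuclideanSpace ℝ (Fin n)) :
      ContMDiffOn 𝓘(ℝ, EuclideanSpace ℝ (Fin n)) (𝓡 n).tangent ∞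
        (fun y ↦ (⟨(extChartAt (𝓡 n) x₀).symm y,
          mfderiv 𝓘(ℝ, EuclideanSpace ℝ (Fin n)) (𝓡 n) (extChartAt (𝓡 n) x₀).symm y v⟩ :
            TangentBundle (𝓡 n) M)) (extChartAt (𝓡 n) x₀).target := by
    have h1 := (contMDiffOn_extChartAt_symm (I := 𝓡 n) (n := ∞) x₀).contMDiffOn_tangentMapWithin
      (m := ∞) le_rfl hT.uniqueMDiffOn
    have h2 : ContMDiffOn 𝓘(ℝ, EuclideanSpace ℝ (Fin n)) 𝓘(ℝ, EuclideanSpace ℝ (Fin n)).tangent ∞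
        (fun y ↦ (⟨y, v⟩ : TangentBundle 𝓘(ℝ, EuclideanSpace ℝ (Fin n))
          (EuclideanSpace ℝ (Fin n)))) (extChartAt (𝓡 n) x₀).target := fun y _ ↦
      contMDiffWithinAt_vectorSpace_iff_contDiffWithinAt.2 contDiffWithinAt_const
    refine (h1.comp h2 fun y hy ↦ hy).congr fun y hy ↦ ?_
    simp only [Function.comp, tangentMapWithin]
    rw [mfderivWithin_of_isOpen hT hy]
  exact ((key v).inner_bundle (key w)).contDiffOn

lemma differentiableAt_gram (x₀ : M) {y : EuclideanSpace ℝ (Fin n)}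
    (hy : y ∈ (extChartAt (𝓡 n) x₀).target) : DifferentiableAt ℝ (gram x₀) y :=
  ((contDiffOn_gram x₀).contDiffAt ((isOpen_extChartAt_target x₀).mem_nhds hy)).differentiableAt
    (by simp)

lemma fderiv_chartMetric (x₀ : M) {y : EuclideanSpace ℝ (Fin n)}
    (hy : y ∈ (extChartAt (𝓡 n) x₀).target) (v w z : EuclideanSpace ℝ (Fin n)) :
    fderiv ℝ (fun y' ↦ chartMetric n x₀ y' v w) y z = fderiv ℝ (gram x₀) y z v w := by
  have h := (((differentiableAt_gram x₀ hy).hasFDerivAt.clm_apply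
    (hasFDerivAt_const v y)).clm_apply (hasFDerivAt_const w y)).fderiv
  simp only [gram_apply] at h
  rw [h]; simp

lemma christoffel_eq (x₀ : M) {y : EuclideanSpace ℝ (Fin n)}
    (hy : y ∈ (extChartAt (𝓡 n) x₀).target) (v z : EuclideanSpace ℝ (Fin n)) :
    christoffel n x₀ y v v z = christoffelForm (gram x₀) y v z := by
  simp only [christoffel, christoffelForm, fderiv_chartMetric x₀ hy]
  simp
  ring

/-- The geodesic equation, solved for the acceleration. -/
lemma geodesic_eq_iff (x₀ : M) {y : EuclideanSpace ℝ (Fin n)}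
    (hy : y ∈ (extChartAt (𝓡 n) x₀).target) (v a : EuclideanSpace ℝ (Fin n)) :
    (∀ z, chartMetric n x₀ y a z + christoffel n x₀ y v v z = 0) ↔
      a = geodesicAccel (gram x₀) (y, v) := by
  rw [← (gram_injective x₀ hy).eq_iff, apply_geodesicAccel (isInvertible_gram x₀ hy),
    ContinuousLinearMap.ext_iff]
  refine forall_congr' fun z ↦ ?_
  rw [christoffel_eq x₀ hy, neg_apply, gram_apply, eq_neg_iff_add_eq_zero]

lemma contDiffOn_geodesicAccel_gram (x₀ : M) :
    ContDiffOn ℝ 1 (geodesicAccel (gram x₀)) ((extChartAt (𝓡 n) x₀).target ×ˢ univ) := by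
  refine fun p hp ↦ (contDiffAt_geodesicAccel ?_ (isInvertible_gram x₀ hp.1)).contDiffWithinAt
  exact ((contDiffOn_gram x₀).contDiffAt ((isOpen_extChartAt_target x₀).mem_nhds hp.1)).of_le
    (by norm_cast)

end

section

/-! ### Geodesic segments as integral curves of the geodesic spray -/

section Abstract

variable {E : Type*} [NormedAddCommGroup E] [NormedSpace ℝ E]

/-- The geodesic spray of the metric `G` on position-velocity pairs. -/
def spray (G : E → E →L[ℝ] E →L[ℝ] ℝ) (p : E × E) : E × E := (p.2, geodesicAccel G p)

lemma hasDerivWithinAt_fst {X : ℝ → E × E} {X' : E × E} {s : Set ℝ} {t : ℝ}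
    (h : HasDerivWithinAt X X' s t) : HasDerivWithinAt (fun t ↦ (X t).1) X'.1 s t :=
  (ContinuousLinearMap.fst ℝ E E).hasFDerivAt.comp_hasDerivWithinAt t h

lemma hasDerivWithinAt_snd {X : ℝ → E × E} {X' : E × E} {s : Set ℝ} {t : ℝ}
    (h : HasDerivWithinAt X X' s t) : HasDerivWithinAt (fun t ↦ (X t).2) X'.2 s t :=
  (ContinuousLinearMap.snd ℝ E E).hasFDerivAt.comp_hasDerivWithinAt t h

lemma contDiffWithinAt_succ_of_hasDerivWithinAt {u v : ℝ → E} {s : Set ℝ} {t : ℝ} {k : ℕ}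
    (ht : t ∈ s) (hu : ∀ᶠ x in 𝓝[s] t, HasDerivWithinAt u (v x) s x)
    (hv : ContDiffWithinAt ℝ k v s t) : ContDiffWithinAt ℝ (k + 1) u s t := by
  obtain ⟨O, hO, h⟩ := mem_nhdsWithin_iff_exists_mem_nhds_inter.1 hu
  refine (contDiffWithinAt_succ_iff_hasFDerivWithinAt' (by simp)).2
    ⟨O ∩ s, ?_, ?_, by simp, fun x ↦ ContinuousLinearMap.toSpanSingleton ℝ (v x), ?_, ?_⟩
  · rw [insert_eq_of_mem ht]; exact inter_mem (mem_nhdsWithin_of_mem_nhds hO) self_mem_nhdsWithin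
  · exact inter_subset_right.trans (subset_insert _ _)
  · exact fun x hx ↦ h hx
  · exact (ContinuousLinearMap.toSpanSingletonCLE (𝕜 := ℝ) (E := E)).contDiff.contDiffAt
      |>.comp_contDiffWithinAt t hv

/-- The position of an integral curve of the spray is twice continuously differentiable. -/
lemma contDiffWithinAt_two_of_spray {G : E → E →L[ℝ] E →L[ℝ] ℝ} {X : ℝ → E × E} {s : Set ℝ} {t : ℝ}
    (ht : t ∈ s) (hX : ∀ᶠ x in 𝓝[s] t, HasDerivWithinAt X (spray G (X x)) s x)
    (hG : ∀ᶠ p in 𝓝 (X t), ContinuousAt (geodesicAccel G) p) :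
    ContDiffWithinAt ℝ 2 (fun t ↦ (X t).1) s t := by
  have hc : ContinuousWithinAt X s t := (hX.self_of_nhdsWithin ht).continuousWithinAt
  have h0 : ContDiffWithinAt ℝ 0 (fun t ↦ geodesicAccel G (X t)) s t := by
    refine contDiffWithinAt_zero ht |>.2 ⟨_, (hc.eventually hG).and hX, fun x hx ↦ ?_⟩
    exact (hx.2.1.comp_continuousWithinAt hx.2.2.continuousWithinAt).mono inter_subset_left
  have h1 := contDiffWithinAt_succ_of_hasDerivWithinAt (k := 0) ht
    (hX.mono fun x hx ↦ hasDerivWithinAt_snd hx) h0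
  exact contDiffWithinAt_succ_of_hasDerivWithinAt (k := 1) ht
    (hX.mono fun x hx ↦ hasDerivWithinAt_fst hx) (by simpa [spray] using h1)

end Abstract

variable {n : ℕ} {M : Type*} [EMetricSpace M] [ChartedSpace (EuclideanSpace ℝ (Fin n)) M]

/-- Position and velocity, in the chart around `x₀`, of the restriction of `γ` to `[a, b]`. The
velocity is one-sided at `a` and `b`, and meaningful only while `γ` is in the domain of the
chart. -/
def chartState (x₀ : M) (γ : ℝ → M) (a b t : ℝ) : EuclideanSpace ℝ (Fin n) ×
    EuclideanSpace ℝ (Fin n) :=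
  (extChartAt (𝓡 n) x₀ (γ t), derivWithin (extChartAt (𝓡 n) x₀ ∘ γ) (Icc a b) t)

lemma eventually_mem_extChartAt_source {γ : ℝ → M} {s : Set ℝ} {t : ℝ} {x₀ : M}
    (hγ : ContinuousWithinAt γ s t) (h : γ t ∈ (extChartAt (𝓡 n) x₀).source) :
    ∀ᶠ t' in 𝓝[s] t, γ t' ∈ (extChartAt (𝓡 n) x₀).source :=
  hγ.preimage_mem_nhdsWithin ((isOpen_extChartAt_source x₀).mem_nhds h)

variable [RiemannianBundle (fun x : M ↦ TangentSpace (𝓡 n) x)]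

lemma IsGeodesicSegment.continuousOn {γ : ℝ → M} {a b : ℝ} (h : IsGeodesicSegment n γ a b) :
    ContinuousOn γ (Icc a b) := h.contMDiffOn.continuousOn

variable [IsManifold (𝓡 n) ∞ M]
  [IsContMDiffRiemannianBundle (𝓡 n) ∞ (EuclideanSpace ℝ (Fin n))
      (fun x : M ↦ TangentSpace (𝓡 n) x)]

lemma IsGeodesicSegment.hasDerivWithinAt_chartState {γ : ℝ → M} {a b : ℝ}
    (h : IsGeodesicSegment n γ a b) (x₀ : M) {t : ℝ} (ht : t ∈ Icc a b)
    (hx : γ t ∈ (extChartAt (𝓡 n) x₀).source) :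
    HasDerivWithinAt (chartState (n := n) x₀ γ a b) (spray (gram x₀) (chartState x₀ γ a b t))
      (Icc a b) t := by
  have hc : ContDiffWithinAt ℝ 2 (extChartAt (𝓡 n) x₀ ∘ γ) (Icc a b) t :=
    contMDiffWithinAt_iff_contDiffWithinAt.1
      ((contMDiffWithinAt_iff_target_of_mem_source (by simpa using hx)).1 (h.contMDiffOn t ht)).2
  have hU := uniqueDiffOn_Icc h.lt
  have h1 := (hc.differentiableWithinAt two_ne_zero).hasDerivWithinAt
  have h2 := ((hc.derivWithin (m := 1) hU (by norm_num) ht).differentiableWithinAt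
    one_ne_zero).hasDerivWithinAt
  rw [(geodesic_eq_iff x₀ ((extChartAt (𝓡 n) x₀).map_source hx) _ _).1
    (h.geodesic_eq x₀ t ht hx)] at h2
  exact h1.prodMk h2

/-- A continuous curve which is locally, in every chart, the position of an integral curve of the
geodesic spray is a geodesic segment. -/
lemma isGeodesicSegment_of_eventually {γ : ℝ → M} {a b : ℝ} (hab : a < b)
    (hγ : ContinuousOn γ (Icc a b))
    (h : ∀ x₀, ∀ t ∈ Icc a b, γ t ∈ (extChartAt (𝓡 n) x₀).source →
      ∃ X : ℝ → EuclideanSpace ℝ (Fin n) × EuclideanSpace ℝ (Fin n), ∀ᶠ t' in 𝓝[Icc a b] t,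
        (X t').1 = extChartAt (𝓡 n) x₀ (γ t') ∧
        HasDerivWithinAt X (spray (gram x₀) (X t')) (Icc a b) t') :
    IsGeodesicSegment n γ a b := by
  have hU := uniqueDiffOn_Icc hab
  refine ⟨hab, fun t ht ↦ ?_, fun x₀ t ht hx ↦ ?_⟩
  · obtain ⟨X, hX⟩ := h (γ t) t ht (mem_extChartAt_source _)
    refine contMDiffWithinAt_iff_target.2 ⟨hγ t ht, contMDiffWithinAt_iff_contDiffWithinAt.2 ?_⟩
    have hX1 : extChartAt (𝓡 n) (γ t) ∘ γ =ᶠ[𝓝[Icc a b] t] fun t ↦ (X t).1 :=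
      hX.mono fun t' h ↦ h.1.symm
    refine (contDiffWithinAt_two_of_spray ht (hX.mono fun t' h ↦ h.2) ?_).congr_of_eventuallyEq
      hX1 (hX1.self_of_nhdsWithin ht)
    have h1 := (hX.self_of_nhdsWithin ht).1
    have hO := (isOpen_extChartAt_target (I := 𝓡 n) (γ t)).prod
      (isOpen_univ (X := EuclideanSpace ℝ (Fin n)))
    filter_upwards [hO.mem_nhds (show X t ∈ _ from
      ⟨by rw [h1]; exact mem_extChartAt_target _, mem_univ _⟩)] with p hp
    exact (contDiffOn_geodesicAccel_gram (γ t)).continuousOn.continuousAt (hO.mem_nhds hp)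
  · obtain ⟨X, hX⟩ := h x₀ t ht hx
    refine (geodesic_eq_iff x₀ ((extChartAt (𝓡 n) x₀).map_source hx) _ _).2 ?_
    have hX1 : extChartAt (𝓡 n) x₀ ∘ γ =ᶠ[𝓝[Icc a b] t] fun t ↦ (X t).1 :=
      hX.mono fun t' h ↦ h.1.symm
    have hX2 : derivWithin (extChartAt (𝓡 n) x₀ ∘ γ) (Icc a b) =ᶠ[𝓝[Icc a b] t]
        fun t ↦ (X t).2 := by
      filter_upwards [eventually_eventually_nhdsWithin.2 hX, hX, self_mem_nhdsWithin]
        with t' h1 h2 ht'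
      have h3 : extChartAt (𝓡 n) x₀ ∘ γ =ᶠ[𝓝[Icc a b] t'] fun t ↦ (X t).1 :=
        h1.mono fun t' h ↦ h.1.symm
      rw [h3.derivWithin_eq (h3.self_of_nhdsWithin ht')]
      exact (hasDerivWithinAt_fst h2.2).derivWithin (hU t' ht')
    have h0 := hX.self_of_nhdsWithin ht
    rw [hX2.derivWithin_eq (hX2.self_of_nhdsWithin ht), hX2.self_of_nhdsWithin ht, ← h0.1]
    exact (hasDerivWithinAt_snd h0.2).derivWithin (hU t ht)

end

section

variable {n : ℕ} {M : Type*} [EMetricSpace M] [ChartedSpace (EuclideanSpace ℝ (Fin n)) M]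

/-! ### Restriction and affine reparametrization -/

lemma chartState_eq_of_hasDerivWithinAt {γ : ℝ → M} {a b : ℝ} (hab : a < b) {x₀ : M} {t : ℝ}
    (ht : t ∈ Icc a b) {X : ℝ → EuclideanSpace ℝ (Fin n) × EuclideanSpace ℝ (Fin n)}
    {G : EuclideanSpace ℝ (Fin n) → EuclideanSpace ℝ (Fin n) →L[ℝ] EuclideanSpace ℝ (Fin n) →L[ℝ] ℝ}
    (hX : ∀ᶠ t' in 𝓝[Icc a b] t, (X t').1 = extChartAt (𝓡 n) x₀ (γ t'))
    (h : HasDerivWithinAt X (spray G (X t)) (Icc a b) t) : chartState x₀ γ a b t = X t := by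
  have hX1 : extChartAt (𝓡 n) x₀ ∘ γ =ᶠ[𝓝[Icc a b] t] fun t ↦ (X t).1 :=
    hX.mono fun t' h ↦ h.symm
  refine Prod.ext (hX.self_of_nhdsWithin ht).symm ?_
  simp only [chartState]
  rw [hX1.derivWithin_eq (hX1.self_of_nhdsWithin ht)]
  exact (hasDerivWithinAt_fst h).derivWithin (uniqueDiffOn_Icc hab t ht)

variable [RiemannianBundle (fun x : M ↦ TangentSpace (𝓡 n) x)] [IsManifold (𝓡 n) ∞ M]
  [IsContMDiffRiemannianBundle (𝓡 n) ∞ (EuclideanSpace ℝ (Fin n))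
      (fun x : M ↦ TangentSpace (𝓡 n) x)]

lemma IsGeodesicSegment.mono {γ : ℝ → M} {a b c d : ℝ} (h : IsGeodesicSegment n γ a b)
    (hcd : c < d) (hs : Icc c d ⊆ Icc a b) : IsGeodesicSegment n γ c d := by
  refine isGeodesicSegment_of_eventually hcd (h.continuousOn.mono hs) fun x₀ t ht hx ↦
    ⟨chartState x₀ γ a b, ?_⟩
  filter_upwards [eventually_mem_extChartAt_source ((h.continuousOn.mono hs) t ht) hx,
    self_mem_nhdsWithin] with t' h1 h2
  exact ⟨rfl, (h.hasDerivWithinAt_chartState x₀ (hs h2) h1).mono hs⟩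

lemma IsGeodesicSegment.chartState_mono {γ : ℝ → M} {a b c d : ℝ} (h : IsGeodesicSegment n γ a b)
    (hcd : c < d) (hs : Icc c d ⊆ Icc a b) {x₀ : M} {t : ℝ} (ht : t ∈ Icc c d)
    (hx : γ t ∈ (extChartAt (𝓡 n) x₀).source) :
    chartState (n := n) x₀ γ c d t = chartState x₀ γ a b t :=
  chartState_eq_of_hasDerivWithinAt hcd ht (Eventually.of_forall fun _ ↦ rfl)
    ((h.hasDerivWithinAt_chartState x₀ (hs ht) hx).mono hs)

/-- The image of an integral curve of the spray under `(y, v) ↦ (y, m • v)`, run at speed `m`, is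
again an integral curve, because `geodesicAccel` is quadratic in the velocity. -/
lemma IsGeodesicSegment.comp_affine {γ : ℝ → M} {a b c d m : ℝ} (h : IsGeodesicSegment n γ a b)
    (hcd : c < d) {e : ℝ} (hs : MapsTo (fun t ↦ m * t + e) (Icc c d) (Icc a b)) :
    IsGeodesicSegment n (fun t ↦ γ (m * t + e)) c d := by
  have hc : ContinuousOn (fun t ↦ γ (m * t + e)) (Icc c d) :=
    h.continuousOn.comp (by fun_prop) hs
  refine isGeodesicSegment_of_eventually hcd hc fun x₀ t ht hx ↦
    ⟨fun t ↦ ((chartState x₀ γ a b (m * t + e)).1, m • (chartState x₀ γ a b (m * t + e)).2), ?_⟩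
  filter_upwards [eventually_mem_extChartAt_source (hc t ht) hx, self_mem_nhdsWithin] with t' h1 h2
  refine ⟨rfl, ?_⟩
  have hd : HasDerivWithinAt (fun t ↦ m * t + e) m (Icc c d) t' := by
    simpa using ((hasDerivWithinAt_id t' _).const_mul m).add_const e
  have hX := (h.hasDerivWithinAt_chartState x₀ (hs h2) h1).scomp t' hd hs
  convert! (hasDerivWithinAt_fst hX).prodMk ((hasDerivWithinAt_snd hX).const_smul m) using 1
  simp [spray, geodesicAccel_smul, smul_smul, pow_two]

/-! ### Speed and length -/

variable (n) in
/-- `γ` has constant speed `v` on `[a, b]`: in every chart, the metric evaluated on the coordinate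
velocity is `v ^ 2`. -/
structure HasSpeed (γ : ℝ → M) (a b v : ℝ) : Prop where
  nonneg : 0 ≤ v
  gram_eq : ∀ x₀ : M, ∀ t ∈ Icc a b, γ t ∈ (extChartAt (𝓡 n) x₀).source →
    gram (n := n) x₀ (chartState x₀ γ a b t).1 (chartState x₀ γ a b t).2
      (chartState x₀ γ a b t).2 = v ^ 2

lemma IsGeodesicSegment.enorm_mfderivWithin {γ : ℝ → M} {a b : ℝ} (h : IsGeodesicSegment n γ a b)
    (x₀ : M) {t : ℝ} (ht : t ∈ Icc a b) (hx : γ t ∈ (extChartAt (𝓡 n) x₀).source) :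
    ‖mfderivWithin 𝓘(ℝ, ℝ) (𝓡 n) γ (Icc a b) t (1 : ℝ)‖ₑ =
      ENNReal.ofReal (√(gram (n := n) x₀ (chartState x₀ γ a b t).1 (chartState x₀ γ a b t).2
        (chartState x₀ γ a b t).2)) := by
  have hU := uniqueDiffOn_Icc h.lt t ht
  have hu := hasDerivWithinAt_fst (h.hasDerivWithinAt_chartState x₀ ht hx)
  have hT := (extChartAt (𝓡 n) x₀).map_source hx
  have hφ := mdifferentiableWithinAt_extChartAt_symm (I := 𝓡 n) hT
  rw [ModelWithCorners.Boundaryless.range_eq_univ, mdifferentiableWithinAt_univ] at hφ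
  have e1 : γ =ᶠ[𝓝[Icc a b] t] (extChartAt (𝓡 n) x₀).symm ∘ (extChartAt (𝓡 n) x₀ ∘ γ) :=
    (eventually_mem_extChartAt_source (h.continuousOn t ht) hx).mono fun t' h ↦
      ((extChartAt (𝓡 n) x₀).left_inv h).symm
  have hm : HasMFDerivWithinAt 𝓘(ℝ, ℝ) (𝓡 n) γ (Icc a b) t
      ((mfderiv 𝓘(ℝ, EuclideanSpace ℝ (Fin n)) (𝓡 n) (extChartAt (𝓡 n) x₀).symm
        (extChartAt (𝓡 n) x₀ (γ t))).comp
          (ContinuousLinearMap.toSpanSingleton ℝ (chartState x₀ γ a b t).2)) :=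
    (hφ.hasMFDerivAt.comp_hasMFDerivWithinAt t
      hu.hasFDerivWithinAt.hasMFDerivWithinAt).congr_of_eventuallyEq e1
      (e1.self_of_nhdsWithin ht)
  rw [hm.mfderivWithin hU.uniqueMDiffWithinAt, ← ofReal_norm]
  congr 1
  rw [norm_eq_sqrt_real_inner]
  congr 1
  -- the two sides live in the tangent spaces at `γ t` and at its image under the chart and back
  have tr (p q : M) (hpq : p = q) (w : EuclideanSpace ℝ (Fin n)) :
      @inner ℝ (TangentSpace (𝓡 n) p) _ w w = @inner ℝ (TangentSpace (𝓡 n) q) _ w w := by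
    subst hpq; rfl
  refine (tr _ _ ((extChartAt (𝓡 n) x₀).left_inv hx).symm _).trans ?_
  exact congrArg (fun w ↦ @inner ℝ (TangentSpace (𝓡 n) ((extChartAt (𝓡 n) x₀).symm
    (extChartAt (𝓡 n) x₀ (γ t)))) _ w w) (congrArg (mfderiv 𝓘(ℝ, EuclideanSpace ℝ (Fin n)) (𝓡 n)
      (extChartAt (𝓡 n) x₀).symm (extChartAt (𝓡 n) x₀ (γ t)))
      (one_smul ℝ (chartState x₀ γ a b t).2))

/-- A geodesic segment has constant speed. -/
lemma IsGeodesicSegment.exists_hasSpeed {γ : ℝ → M} {a b : ℝ} (h : IsGeodesicSegment n γ a b) :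
    ∃ v : ℝ, HasSpeed n γ a b v := by
  set f : ℝ → ℝ :=
    fun t ↦ (‖mfderivWithin 𝓘(ℝ, ℝ) (𝓡 n) γ (Icc a b) t (1 : ℝ)‖ₑ).toReal ^ 2 with hf
  have key (x₀ : M) (t : ℝ) (ht : t ∈ Icc a b) (hx : γ t ∈ (extChartAt (𝓡 n) x₀).source) :
      f t = gram (n := n) x₀ (chartState x₀ γ a b t).1 (chartState x₀ γ a b t).2
        (chartState x₀ γ a b t).2 := by
    simp only [hf]
    rw [h.enorm_mfderivWithin x₀ ht hx, ENNReal.toReal_ofReal (Real.sqrt_nonneg _),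
      Real.sq_sqrt (gram_self_nonneg _ _ _)]
  have hd : ∀ t ∈ Icc a b, HasDerivWithinAt f 0 (Icc a b) t := by
    intro t₀ ht
    have hx := mem_extChartAt_source (I := 𝓡 n) (γ t₀)
    have hT := (extChartAt (𝓡 n) (γ t₀)).map_source hx
    have hX := h.hasDerivWithinAt_chartState (γ t₀) ht hx
    have hg : HasDerivWithinAt (fun t ↦ gram (n := n) (γ t₀) (chartState (γ t₀) γ a b t).1
        (chartState (γ t₀) γ a b t).2 (chartState (γ t₀) γ a b t).2) 0 (Icc a b) t₀ :=
      hasDerivWithinAt_apply_self_of_geodesicAccel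
        (u := fun t ↦ (chartState (γ t₀) γ a b t).1) (w := fun t ↦ (chartState (γ t₀) γ a b t).2)
        (differentiableAt_gram (γ t₀) hT) (isInvertible_gram (γ t₀) hT) (gram_symm _ _)
        (hasDerivWithinAt_fst hX) (hasDerivWithinAt_snd hX)
    refine hg.congr_of_eventuallyEq ?_ (key _ t₀ ht hx)
    filter_upwards [eventually_mem_extChartAt_source (h.continuousOn t₀ ht) hx,
      self_mem_nhdsWithin] with t' h1 h2
    exact key _ t' h2 h1
  have hc := constant_of_derivWithin_zero (fun t ht ↦ (hd t ht).differentiableWithinAt)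
    fun t ht ↦ (hd t (Ico_subset_Icc_self ht)).derivWithin
      (uniqueDiffOn_Icc h.lt t (Ico_subset_Icc_self ht))
  refine ⟨√(f a), Real.sqrt_nonneg _, fun x₀ t ht hx ↦ ?_⟩
  rw [Real.sq_sqrt (by positivity), ← hc t ht, key x₀ t ht hx]

lemma HasSpeed.mono {γ : ℝ → M} {a b c d v : ℝ} (hv : HasSpeed n γ a b v)
    (h : IsGeodesicSegment n γ a b) (hcd : c < d) (hs : Icc c d ⊆ Icc a b) :
    HasSpeed n γ c d v := by
  refine ⟨hv.nonneg, fun x₀ t ht hx ↦ ?_⟩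
  rw [h.chartState_mono hcd hs ht hx]
  exact hv.gram_eq x₀ t (hs ht) hx

lemma HasSpeed.pathELength_eq {γ : ℝ → M} {a b v : ℝ} (hv : HasSpeed n γ a b v)
    (h : IsGeodesicSegment n γ a b) :
    Manifold.pathELength (𝓡 n) γ a b = ENNReal.ofReal (v * (b - a)) := by
  rw [Manifold.pathELength_eq_lintegral_mfderivWithin_Icc]
  have : ∀ t ∈ Icc a b, ‖mfderivWithin 𝓘(ℝ, ℝ) (𝓡 n) γ (Icc a b) t (1 : ℝ)‖ₑ =
      ENNReal.ofReal v := fun t ht ↦ by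
    have hx := mem_extChartAt_source (I := 𝓡 n) (γ t)
    rw [h.enorm_mfderivWithin _ ht hx, hv.gram_eq _ t ht hx, Real.sqrt_sq hv.nonneg]
  refine (MeasureTheory.setLIntegral_congr_fun measurableSet_Icc this).trans ?_
  rw [MeasureTheory.setLIntegral_const, Real.volume_Icc, ENNReal.ofReal_mul hv.nonneg]

lemma IsMinimizingGeodesic.edist_eq_ofReal {γ : ℝ → M} {a b v : ℝ}
    (h : IsMinimizingGeodesic n γ a b) (hv : HasSpeed n γ a b v) :
    edist (γ a) (γ b) = ENNReal.ofReal (v * (b - a)) := by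
  rw [← h.length_eq, hv.pathELength_eq h.isGeodesicSegment]

/-- The speed of a minimizing geodesic is the distance of its endpoints divided by the length of
its parameter interval. -/
lemma IsMinimizingGeodesic.hasSpeed {γ : ℝ → M} {a b : ℝ} (h : IsMinimizingGeodesic n γ a b) :
    HasSpeed n γ a b ((edist (γ a) (γ b)).toReal / (b - a)) := by
  obtain ⟨v, hv⟩ := h.isGeodesicSegment.exists_hasSpeed
  have hab := sub_pos.2 h.isGeodesicSegment.lt
  rwa [h.edist_eq_ofReal hv, ENNReal.toReal_ofReal (mul_nonneg hv.nonneg hab.le),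
    mul_div_cancel_right₀ _ hab.ne']

lemma IsMinimizingGeodesic.comp_affine {γ : ℝ → M} {a b c d m e : ℝ}
    (h : IsMinimizingGeodesic n γ a b) (hcd : c < d) (hm : 0 ≤ m) (hc : m * c + e = a)
    (hd : m * d + e = b) : IsMinimizingGeodesic n (fun t ↦ γ (m * t + e)) c d := by
  have hmono : Monotone fun t ↦ m * t + e := fun x y hxy ↦ by
    simpa using mul_le_mul_of_nonneg_left hxy hm
  subst hc hd
  refine ⟨h.isGeodesicSegment.comp_affine hcd fun t ht ↦ ⟨hmono ht.1, hmono ht.2⟩, ?_⟩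
  rw [← h.length_eq]
  exact Manifold.pathELength_comp_of_monotoneOn (f := fun t ↦ m * t + e) hcd.le
    (hmono.monotoneOn _) (by fun_prop)
    (h.isGeodesicSegment.contMDiffOn.mdifferentiableOn two_ne_zero)

variable [IsRiemannianManifold (𝓡 n) M]

lemma IsGeodesicSegment.edist_le {γ : ℝ → M} {a b v s t : ℝ} (h : IsGeodesicSegment n γ a b)
    (hv : HasSpeed n γ a b v) (hs : a ≤ s) (hst : s ≤ t) (ht : t ≤ b) :
    edist (γ s) (γ t) ≤ ENNReal.ofReal (v * (t - s)) := by
  rcases hst.eq_or_lt with rfl | hst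
  · simp
  have hsub := Icc_subset_Icc hs ht
  rw [← (hv.mono h hst hsub).pathELength_eq (h.mono hst hsub),
    IsRiemannianManifold.out (I := 𝓡 n) (γ s) (γ t)]
  exact Manifold.riemannianEDist_le_pathELength
    ((h.contMDiffOn.of_le one_le_two).mono hsub) rfl rfl hst.le

lemma IsMinimizingGeodesic.edist_eq_of_le {γ : ℝ → M} {a b v s t : ℝ}
    (h : IsMinimizingGeodesic n γ a b) (hv : HasSpeed n γ a b v) (hs : a ≤ s) (hst : s ≤ t)
    (ht : t ≤ b) : edist (γ s) (γ t) = ENNReal.ofReal (v * (t - s)) := by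
  have hg := h.isGeodesicSegment
  refine le_antisymm (hg.edist_le hv hs hst ht) ?_
  have h1 := hg.edist_le hv le_rfl hs (hst.trans ht)
  have h2 := hg.edist_le hv (hs.trans hst) ht le_rfl
  have h3 : ENNReal.ofReal (v * (b - a)) ≤ ENNReal.ofReal (v * (s - a)) + edist (γ s) (γ t) +
      ENNReal.ofReal (v * (b - t)) := by
    rw [← h.edist_eq_ofReal hv]
    exact (edist_triangle4 _ (γ s) (γ t) _).trans (by gcongr)
  have hv0 := hv.nonneg
  have e1 : v * (b - a) = v * (s - a) + v * (t - s) + v * (b - t) := by ring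
  have p1 : 0 ≤ v * (s - a) := mul_nonneg hv0 (by linarith)
  have p2 : 0 ≤ v * (t - s) := mul_nonneg hv0 (by linarith)
  have p3 : 0 ≤ v * (b - t) := mul_nonneg hv0 (by linarith)
  rw [e1, ENNReal.ofReal_add (add_nonneg p1 p2) p3, ENNReal.ofReal_add p1 p2] at h3
  exact (ENNReal.add_le_add_iff_left ENNReal.ofReal_ne_top).1
    ((ENNReal.add_le_add_iff_right ENNReal.ofReal_ne_top).1 h3)

lemma IsMinimizingGeodesic.edist_eq {γ : ℝ → M} {a b v s t : ℝ}
    (h : IsMinimizingGeodesic n γ a b) (hv : HasSpeed n γ a b v) (hs : s ∈ Icc a b)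
    (ht : t ∈ Icc a b) : edist (γ s) (γ t) = ENNReal.ofReal (v * |t - s|) := by
  rcases le_total s t with hst | hst
  · rw [h.edist_eq_of_le hv hs.1 hst ht.2, abs_of_nonneg (sub_nonneg.2 hst)]
  · rw [edist_comm, h.edist_eq_of_le hv ht.1 hst hs.2, abs_sub_comm,
      abs_of_nonneg (sub_nonneg.2 hst)]

lemma IsMinimizingGeodesic.mono {γ : ℝ → M} {a b c d : ℝ} (h : IsMinimizingGeodesic n γ a b)
    (hcd : c < d) (hac : a ≤ c) (hdb : d ≤ b) : IsMinimizingGeodesic n γ c d := by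
  obtain ⟨v, hv⟩ := h.isGeodesicSegment.exists_hasSpeed
  have hs := Icc_subset_Icc hac hdb
  refine ⟨h.isGeodesicSegment.mono hcd hs, ?_⟩
  rw [(hv.mono h.isGeodesicSegment hcd hs).pathELength_eq (h.isGeodesicSegment.mono hcd hs),
    h.edist_eq_of_le hv hac hcd.le hdb]

end

section

/-! ### Limits of integral curves -/

section Abstract

variable {F : Type*} [NormedAddCommGroup F] [NormedSpace ℝ F]

/-- A solution of `X' = Φ(X)` which stays in a set on which `Φ` is bounded and Lipschitz satisfies
the first-order Taylor formula with a uniform quadratic error. -/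
lemma norm_sub_sub_smul_le_of_hasDerivWithinAt {Φ : F → F} {K : Set F} {s : Set ℝ} {X : ℝ → F}
    {L : NNReal} {A : ℝ} (hs : Convex ℝ s) (hΦ : LipschitzOnWith L Φ K) (hA : ∀ p ∈ K, ‖Φ p‖ ≤ A)
    (hK : ∀ t ∈ s, X t ∈ K) (hX : ∀ t ∈ s, HasDerivWithinAt X (Φ (X t)) s t) {x y : ℝ}
    (hx : x ∈ s) (hy : y ∈ s) :
    ‖X y - X x - (y - x) • Φ (X x)‖ ≤ L * A * ‖y - x‖ ^ 2 := by
  have h1 (z : ℝ) (hz : z ∈ s) : ‖X z - X x‖ ≤ A * ‖z - x‖ :=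
    hs.norm_image_sub_le_of_norm_hasDerivWithin_le hX (fun t ht ↦ hA _ (hK t ht)) hx hz
  have hA0 : 0 ≤ A := (norm_nonneg _).trans (hA _ (hK x hx))
  set T := s ∩ Metric.closedBall x ‖y - x‖ with hT
  have hTc : Convex ℝ T := hs.inter (convex_closedBall _ _)
  have hd (t : ℝ) (ht : t ∈ T) : HasDerivWithinAt (fun z ↦ X z - (z - x) • Φ (X x))
      (Φ (X t) - Φ (X x)) T t := by
    have h2 : HasDerivWithinAt (fun z ↦ (z - x) • Φ (X x)) (Φ (X x)) T t := by
      simpa using ((hasDerivWithinAt_id t T).sub_const x).smul_const (Φ (X x))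
    exact ((hX t ht.1).mono inter_subset_left).sub h2
  have hb (t : ℝ) (ht : t ∈ T) : ‖Φ (X t) - Φ (X x)‖ ≤ L * (A * ‖y - x‖) := by
    have h2 : ‖t - x‖ ≤ ‖y - x‖ := by simpa [dist_eq_norm] using ht.2
    calc ‖Φ (X t) - Φ (X x)‖ ≤ L * ‖X t - X x‖ := by
          simpa [dist_eq_norm] using hΦ.dist_le_mul _ (hK t ht.1) _ (hK x hx)
      _ ≤ L * (A * ‖y - x‖) := by
          gcongr
          exact (h1 t ht.1).trans (by gcongr)
  have h3 := hTc.norm_image_sub_le_of_norm_hasDerivWithin_le hd hb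
    (⟨hx, by simp⟩ : x ∈ T) (⟨hy, by simp [dist_eq_norm]⟩ : y ∈ T)
  calc _ = ‖X y - (y - x) • Φ (X x) - (X x - (x - x) • Φ (X x))‖ := by
        congr 1; simp; abel
    _ ≤ _ := h3.trans_eq (by ring)

/-- A pointwise limit of solutions of `X' = Φ(X)` that stay in a closed set on which `Φ` is bounded
and Lipschitz is again a solution. -/
lemma hasDerivWithinAt_of_tendsto {ι : Type*} {l : Filter ι} [l.NeBot] {Φ : F → F} {K : Set F}
    {s : Set ℝ} {X : ι → ℝ → F} {Y : ℝ → F} {L : NNReal} {A : ℝ} (hs : Convex ℝ s)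
    (hΦ : LipschitzOnWith L Φ K) (hA : ∀ p ∈ K, ‖Φ p‖ ≤ A) (hKc : IsClosed K)
    (hX : ∀ᶠ i in l, ∀ t ∈ s, X i t ∈ K ∧ HasDerivWithinAt (X i) (Φ (X i t)) s t)
    (hY : ∀ t ∈ s, Tendsto (fun i ↦ X i t) l (𝓝 (Y t))) {t : ℝ} (ht : t ∈ s) :
    HasDerivWithinAt Y (Φ (Y t)) s t := by
  have hYK (x : ℝ) (hx : x ∈ s) : Y x ∈ K :=
    hKc.mem_of_tendsto (hY x hx) (hX.mono fun i h ↦ (h x hx).1)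
  have hΦY : Tendsto (fun i ↦ Φ (X i t)) l (𝓝 (Φ (Y t))) :=
    (hΦ.continuousOn (Y t) (hYK t ht)).tendsto.comp
      (tendsto_nhdsWithin_iff.2 ⟨hY t ht, hX.mono fun i h ↦ (h t ht).1⟩)
  have key (y : ℝ) (hy : y ∈ s) : ‖Y y - Y t - (y - t) • Φ (Y t)‖ ≤ L * A * ‖y - t‖ ^ 2 := by
    refine le_of_tendsto (((hY y hy).sub (hY t ht)).sub (hΦY.const_smul (y - t))).norm ?_
    filter_upwards [hX] with i hi
    exact norm_sub_sub_smul_le_of_hasDerivWithinAt hs hΦ hA (fun t ht ↦ (hi t ht).1)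
      (fun t ht ↦ (hi t ht).2) ht hy
  rw [hasDerivWithinAt_iff_isLittleO]
  have hO : (fun y ↦ Y y - Y t - (y - t) • Φ (Y t)) =O[𝓝[s] t] fun y ↦ ‖y - t‖ ^ 2 :=
    Asymptotics.IsBigO.of_bound (L * A) (by
      filter_upwards [self_mem_nhdsWithin] with y hy
      simpa using key y hy)
  refine hO.trans_isLittleO ?_
  have h0 : Tendsto (fun y ↦ y - t) (𝓝[s] t) (𝓝 0) := by
    have : Tendsto (fun y ↦ y - t) (𝓝 t) (𝓝 (t - t)) :=
      (continuous_id.sub continuous_const).tendsto t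
    rw [sub_self] at this
    exact this.mono_left nhdsWithin_le_nhds
  exact ((Asymptotics.isLittleO_norm_pow_id one_lt_two).comp_tendsto h0)

lemma tendsto_bilin_apply_self {ι : Type*} {l : Filter ι} {B : ι → F →L[ℝ] F →L[ℝ] ℝ}
    {B₀ : F →L[ℝ] F →L[ℝ] ℝ} {v : ι → F} {v₀ : F} (hB : Tendsto B l (𝓝 B₀))
    (hv : Tendsto v l (𝓝 v₀)) : Tendsto (fun i ↦ B i (v i) (v i)) l (𝓝 (B₀ v₀ v₀)) :=
  have hc : Continuous fun p : (F →L[ℝ] F →L[ℝ] ℝ) × F ↦ p.1 p.2 p.2 := by fun_prop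
  (hc.tendsto (B₀, v₀)).comp (hB.prodMk_nhds hv)

end Abstract

variable {n : ℕ} {M : Type*} [EMetricSpace M] [ChartedSpace (EuclideanSpace ℝ (Fin n)) M]
  [RiemannianBundle (fun x : M ↦ TangentSpace (𝓡 n) x)] [IsManifold (𝓡 n) ∞ M]
  [IsContMDiffRiemannianBundle (𝓡 n) ∞ (EuclideanSpace ℝ (Fin n))
      (fun x : M ↦ TangentSpace (𝓡 n) x)]

/-- The metric is uniformly positive definite near a point, by compactness of the unit sphere. -/
lemma exists_closedBall_forall_le_gram (x₀ : M) {y₀ : EuclideanSpace ℝ (Fin n)}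
    (hy₀ : y₀ ∈ (extChartAt (𝓡 n) x₀).target) :
    ∃ r > 0, Metric.closedBall y₀ r ⊆ (extChartAt (𝓡 n) x₀).target ∧
      ∃ c > 0, ∀ y ∈ Metric.closedBall y₀ r, ∀ v, c * ‖v‖ ^ 2 ≤ gram x₀ y v v := by
  obtain ⟨r, hr, hrT⟩ := Metric.nhds_basis_closedBall.mem_iff.1
    ((isOpen_extChartAt_target (I := 𝓡 n) x₀).mem_nhds hy₀)
  refine ⟨r, hr, hrT, ?_⟩
  have hK : IsCompact (Metric.closedBall y₀ r ×ˢ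
      Metric.sphere (0 : EuclideanSpace ℝ (Fin n)) 1) :=
    (isCompact_closedBall _ _).prod (isCompact_sphere _ _)
  have hc : ContinuousOn (fun p : EuclideanSpace ℝ (Fin n) × EuclideanSpace ℝ (Fin n) ↦
      gram x₀ p.1 p.2 p.2) (Metric.closedBall y₀ r ×ˢ Metric.sphere 0 1) :=
    ((((contDiffOn_gram x₀).continuousOn.mono hrT).comp continuousOn_fst fun p hp ↦ hp.1).clm_apply
      continuousOn_snd).clm_apply continuousOn_snd
  obtain ⟨c, hc0, hcle⟩ := hK.exists_forall_le' hc (a := 0) fun p hp ↦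
    gram_self_pos x₀ (hrT hp.1) (by
      rintro h0
      have := hp.2
      simp [h0] at this)
  refine ⟨c, hc0, fun y hy v ↦ ?_⟩
  rcases eq_or_ne v 0 with rfl | hv
  · simp
  have h1 := hcle (y, ‖v‖⁻¹ • v) ⟨hy, by simp [norm_smul, hv]⟩
  have hv' : 0 < ‖v‖ := norm_pos_iff.2 hv
  simp only [map_smul, smul_apply, smul_eq_mul] at h1
  calc c * ‖v‖ ^ 2 ≤ (‖v‖⁻¹ * (‖v‖⁻¹ * gram x₀ y v v)) * ‖v‖ ^ 2 := by gcongr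
    _ = gram x₀ y v v := by field_simp

end

section

variable {n : ℕ} {M : Type*} [EMetricSpace M] [ChartedSpace (EuclideanSpace ℝ (Fin n)) M]
  [RiemannianBundle (fun x : M ↦ TangentSpace (𝓡 n) x)] [IsManifold (𝓡 n) ∞ M]
  [IsContMDiffRiemannianBundle (𝓡 n) ∞ (EuclideanSpace ℝ (Fin n))
      (fun x : M ↦ TangentSpace (𝓡 n) x)]

lemma exists_pos_ofReal_mul_lt (v : ℝ) {ε : ENNReal} (hε : 0 < ε) :
    ∃ δ > 0, ENNReal.ofReal (v * δ) < ε := by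
  have h : Tendsto (fun δ ↦ ENNReal.ofReal (v * δ)) (𝓝 0) (𝓝 (ENNReal.ofReal (v * 0))) :=
    (ENNReal.continuous_ofReal.comp (by fun_prop : Continuous fun δ ↦ v * δ)).tendsto 0
  rw [mul_zero, ENNReal.ofReal_zero] at h
  obtain ⟨δ, h1, h2⟩ := (((h.mono_left nhdsWithin_le_nhds).eventually (gt_mem_nhds hε)).and
    (self_mem_nhdsWithin (s := Ioi 0))).exists
  exact ⟨δ, h2, h1⟩

lemma contDiffOn_spray_gram (x₀ : M) :
    ContDiffOn ℝ 1 (spray (gram (n := n) x₀)) ((extChartAt (𝓡 n) x₀).target ×ˢ univ) :=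
  contDiff_snd.contDiffOn.prodMk (contDiffOn_geodesicAccel_gram x₀)

lemma IsMinimizingGeodesic.edist_ne_top {γ : ℝ → M} {a b : ℝ} (h : IsMinimizingGeodesic n γ a b) :
    edist (γ a) (γ b) ≠ ⊤ := by
  rw [h.edist_eq_ofReal h.hasSpeed]
  exact ENNReal.ofReal_ne_top

variable [IsRiemannianManifold (𝓡 n) M]

/-! ### Limits of minimizing geodesics -/

variable {ι : Type*} {l : Filter ι} {σ : ι → ℝ → M} {τ : ℝ → M} {a b : ℝ}

omit [IsRiemannianManifold (𝓡 n) M] in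
lemma edist_ne_top_of_tendsto [l.NeBot] (hσ : ∀ᶠ i in l, IsMinimizingGeodesic n (σ i) a b)
    {p q : M} (hp : Tendsto (fun i ↦ σ i a) l (𝓝 p)) (hq : Tendsto (fun i ↦ σ i b) l (𝓝 q)) :
    edist p q ≠ ⊤ := by
  obtain ⟨i, hi, h1, h2⟩ := (hσ.and ((hp.eventually (Metric.eball_mem_nhds p one_pos)).and
    (hq.eventually (Metric.eball_mem_nhds q one_pos)))).exists
  refine ((edist_triangle4 p (σ i a) (σ i b) q).trans_lt ?_).ne
  rw [edist_comm p]
  exact ENNReal.add_lt_top.2 ⟨ENNReal.add_lt_top.2 ⟨lt_trans h1 ENNReal.one_lt_top,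
    hi.edist_ne_top.lt_top⟩, lt_trans h2 ENNReal.one_lt_top⟩

omit [IsRiemannianManifold (𝓡 n) M] in
lemma tendsto_speed [l.NeBot] (hσ : ∀ᶠ i in l, IsMinimizingGeodesic n (σ i) a b)
    {p q : M} (hp : Tendsto (fun i ↦ σ i a) l (𝓝 p)) (hq : Tendsto (fun i ↦ σ i b) l (𝓝 q)) :
    Tendsto (fun i ↦ (edist (σ i a) (σ i b)).toReal / (b - a)) l
      (𝓝 ((edist p q).toReal / (b - a))) :=
  ((ENNReal.tendsto_toReal (edist_ne_top_of_tendsto hσ hp hq)).comp (hp.edist hq)).div_const _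

/-- Distances pass to the limit: a pointwise limit of minimizing geodesics is a metric geodesic. -/
lemma edist_eq_of_tendsto [l.NeBot] {V : ι → ℝ} {v : ℝ}
    (hσ : ∀ᶠ i in l, IsMinimizingGeodesic n (σ i) a b ∧ HasSpeed n (σ i) a b (V i))
    (hV : Tendsto V l (𝓝 v)) {s t : ℝ} (hs : s ∈ Icc a b) (ht : t ∈ Icc a b) {x y : M}
    (hx : Tendsto (fun i ↦ σ i s) l (𝓝 x)) (hy : Tendsto (fun i ↦ σ i t) l (𝓝 y)) :
    edist x y = ENNReal.ofReal (v * |t - s|) := by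
  refine tendsto_nhds_unique (hx.edist hy)
    ((ENNReal.tendsto_ofReal (hV.mul_const |t - s|)).congr' ?_)
  filter_upwards [hσ] with i hi
  exact (hi.1.edist_eq hi.2 hs ht).symm

lemma continuousOn_of_edist_eq {v : ℝ}
    (h : ∀ s ∈ Icc a b, ∀ t ∈ Icc a b, edist (τ s) (τ t) = ENNReal.ofReal (v * |t - s|)) :
    ContinuousOn τ (Icc a b) := by
  intro t ht
  rw [ContinuousWithinAt, tendsto_iff_edist_tendsto_0]
  have h0 : Tendsto (fun s ↦ ENNReal.ofReal (v * |t - s|)) (𝓝[Icc a b] t) (𝓝 0) := by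
    have : Tendsto (fun s ↦ ENNReal.ofReal (v * |t - s|)) (𝓝 t)
        (𝓝 (ENNReal.ofReal (v * |t - t|))) :=
      (ENNReal.continuous_ofReal.comp (by fun_prop : Continuous fun s ↦ v * |t - s|)).tendsto t
    simp only [sub_self, abs_zero, mul_zero, ENNReal.ofReal_zero] at this
    exact this.mono_left nhdsWithin_le_nhds
  refine h0.congr' ?_
  filter_upwards [self_mem_nhdsWithin] with s hs
  exact (h s hs t ht).symm

/-- Along an ultrafilter, the positions and velocities in a chart of pointwise converging minimizing
geodesics of bounded speed converge to an integral curve of the geodesic spray: the velocities are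
bounded because the metric is bounded below near the limit point, so that all these integral curves
stay in a compact set. -/
lemma exists_hasDerivWithinAt_spray_of_tendsto {U : Ultrafilter ι} {V : ι → ℝ} {v : ℝ}
    (hσ : ∀ᶠ i in U, IsMinimizingGeodesic n (σ i) a b ∧ HasSpeed n (σ i) a b (V i))
    (hV : Tendsto V U (𝓝 v)) (hτ : ∀ t ∈ Icc a b, Tendsto (fun i ↦ σ i t) U (𝓝 (τ t)))
    (x₀ : M) {t₀ : ℝ} (ht₀ : t₀ ∈ Icc a b) (hx : τ t₀ ∈ (extChartAt (𝓡 n) x₀).source) :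
    ∃ Y : ℝ → EuclideanSpace ℝ (Fin n) × EuclideanSpace ℝ (Fin n),
      (∀ᶠ t in 𝓝[Icc a b] t₀, (Y t).1 = extChartAt (𝓡 n) x₀ (τ t) ∧
        HasDerivWithinAt Y (spray (gram x₀) (Y t)) (Icc a b) t) ∧
      Tendsto (fun i ↦ chartState x₀ (σ i) a b t₀) U (𝓝 (Y t₀)) := by
  have hT := (extChartAt (𝓡 n) x₀).map_source hx
  set u₀ := extChartAt (𝓡 n) x₀ (τ t₀) with hu₀
  obtain ⟨r, hr, hrT, c, hc, hcG⟩ := exists_closedBall_forall_le_gram x₀ hT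
  have hv0 : 0 ≤ v := ge_of_tendsto hV (hσ.mono fun i h ↦ h.2.nonneg)
  -- a metric ball around `τ t₀` whose image in the chart lies in the closed ball of radius `r`
  obtain ⟨ρ, hρ, hρO⟩ := EMetric.mem_nhds_iff.1 (inter_mem (extChartAt_source_mem_nhds' hx)
    ((continuousAt_extChartAt' hx).preimage_mem_nhds (Metric.closedBall_mem_nhds u₀ hr)))
  obtain ⟨δ, hδ, hδρ⟩ := exists_pos_ofReal_mul_lt (v + 1) (ENNReal.half_pos hρ.ne')
  set J := Icc a b ∩ Metric.closedBall t₀ δ with hJ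
  have hJc : Convex ℝ J := (convex_Icc a b).inter (convex_closedBall _ _)
  have ht₀J : t₀ ∈ J := ⟨ht₀, Metric.mem_closedBall_self hδ.le⟩
  set R := (v + 1) / √c with hR
  set K := Metric.closedBall u₀ r ×ˢ Metric.closedBall (0 : EuclideanSpace ℝ (Fin n)) R with hK
  have hKc : IsCompact K := (isCompact_closedBall _ _).prod (isCompact_closedBall _ _)
  have hKT : K ⊆ (extChartAt (𝓡 n) x₀).target ×ˢ univ := fun p hp ↦ ⟨hrT hp.1, mem_univ _⟩
  have hsm := (contDiffOn_spray_gram x₀).mono hKT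
  obtain ⟨L, hL⟩ := hsm.exists_lipschitzOnWith one_ne_zero
    ((convex_closedBall _ _).prod (convex_closedBall _ _)) hKc
  obtain ⟨A, hA⟩ := hKc.exists_bound_of_continuousOn hsm.continuousOn
  have hmem : ∀ᶠ i in U, ∀ t ∈ J, chartState x₀ (σ i) a b t ∈ K ∧
      HasDerivWithinAt (chartState x₀ (σ i) a b)
        (spray (gram (n := n) x₀) (chartState x₀ (σ i) a b t)) J t := by
    filter_upwards [hσ, hV.eventually (ge_mem_nhds (lt_add_one v)),
      (hτ t₀ ht₀).eventually (Metric.eball_mem_nhds _ (ENNReal.half_pos hρ.ne'))]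
      with i hi hVi hti t ht
    have h1 : edist (σ i t) (τ t₀) < ρ := by
      refine (edist_triangle _ (σ i t₀) _).trans_lt ?_
      rw [← ENNReal.add_halves ρ]
      refine ENNReal.add_lt_add (lt_of_le_of_lt ?_ hδρ) hti
      rw [hi.1.edist_eq hi.2 ht.1 ht₀]
      refine ENNReal.ofReal_le_ofReal (mul_le_mul hVi ?_ (abs_nonneg _) (by positivity))
      rw [abs_sub_comm]
      exact ht.2
    obtain ⟨h2, h3⟩ := hρO h1
    refine ⟨⟨h3, ?_⟩, (hi.1.isGeodesicSegment.hasDerivWithinAt_chartState x₀ ht.1 h2).mono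
      inter_subset_left⟩
    have h4 := (hcG _ h3 (chartState x₀ (σ i) a b t).2).trans_eq (hi.2.gram_eq x₀ t ht.1 h2)
    rw [mem_closedBall_zero_iff, hR, le_div_iff₀ (Real.sqrt_pos.2 hc)]
    refine (abs_le_of_sq_le_sq' ?_ (by positivity)).2
    calc _ = c * ‖(chartState x₀ (σ i) a b t).2‖ ^ 2 := by
          rw [mul_pow, Real.sq_sqrt hc.le, mul_comm]
      _ ≤ V i ^ 2 := h4
      _ ≤ (v + 1) ^ 2 := pow_le_pow_left₀ hi.2.nonneg hVi 2
  have hlim : ∀ t ∈ J, ∃ p, Tendsto (fun i ↦ chartState (n := n) x₀ (σ i) a b t) U (𝓝 p) :=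
    fun t ht ↦ by
      obtain ⟨p, -, hp⟩ := hKc.ultrafilter_le_nhds (U.map fun i ↦ chartState x₀ (σ i) a b t)
        (le_principal_iff.2 (hmem.mono fun i h ↦ (h t ht).1))
      exact ⟨p, hp⟩
  choose! Y hY using hlim
  have hsource : ∀ t ∈ J, τ t ∈ (extChartAt (𝓡 n) x₀).source := fun t ht ↦ by
    have h1 : edist (τ t) (τ t₀) < ρ := by
      rw [edist_eq_of_tendsto hσ hV ht.1 ht₀ (hτ t ht.1) (hτ t₀ ht₀)]
      refine (lt_of_le_of_lt (ENNReal.ofReal_le_ofReal ?_) hδρ).trans_le ENNReal.half_le_self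
      rw [abs_sub_comm]
      exact mul_le_mul (by linarith) ht.2 (abs_nonneg _) (by positivity)
    exact (hρO h1).1
  refine ⟨Y, ?_, hY t₀ ht₀J⟩
  filter_upwards [inter_mem_nhdsWithin (Icc a b) (Metric.ball_mem_nhds t₀ hδ)] with t ht
  have htJ : t ∈ J := ⟨ht.1, Metric.ball_subset_closedBall ht.2⟩
  refine ⟨?_, ?_⟩
  · have h1 : Tendsto (fun i ↦ extChartAt (𝓡 n) x₀ (σ i t)) U (𝓝 (extChartAt (𝓡 n) x₀ (τ t))) :=
      (continuousAt_extChartAt' (hsource t htJ)).tendsto.comp (hτ t ht.1)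
    exact tendsto_nhds_unique ((continuous_fst.tendsto _).comp (hY t htJ)) h1
  · refine (hasDerivWithinAt_of_tendsto hJc hL hA hKc.isClosed hmem hY
      htJ).mono_of_mem_nhdsWithin ?_
    exact inter_mem self_mem_nhdsWithin (mem_nhdsWithin_of_mem_nhds
      (mem_of_superset (Metric.isOpen_ball.mem_nhds ht.2) Metric.ball_subset_closedBall))

/-- A pointwise limit of minimizing geodesics is a minimizing geodesic. -/
lemma IsMinimizingGeodesic.of_tendsto [l.NeBot] (hab : a < b)
    (hσ : ∀ᶠ i in l, IsMinimizingGeodesic n (σ i) a b)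
    (hτ : ∀ t ∈ Icc a b, Tendsto (fun i ↦ σ i t) l (𝓝 (τ t))) :
    IsMinimizingGeodesic n τ a b := by
  have hU : (Ultrafilter.of l : Filter ι) ≤ l := Ultrafilter.of_le l
  replace hσ := hσ.filter_mono hU
  replace hτ := fun t ht ↦ (hτ t ht).mono_left hU
  have ha := left_mem_Icc.2 hab.le
  have hb := right_mem_Icc.2 hab.le
  have hV := tendsto_speed hσ (hτ a ha) (hτ b hb)
  replace hσ := hσ.mono fun i h ↦ And.intro h h.hasSpeed
  have hd (s) (hs : s ∈ Icc a b) (t) (ht : t ∈ Icc a b) :=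
    edist_eq_of_tendsto hσ hV hs ht (hτ s hs) (hτ t ht)
  have hg : IsGeodesicSegment n τ a b :=
    isGeodesicSegment_of_eventually hab (continuousOn_of_edist_eq hd) fun x₀ t ht hx ↦ by
      obtain ⟨Y, hY, -⟩ := exists_hasDerivWithinAt_spray_of_tendsto hσ hV hτ x₀ ht hx
      exact ⟨Y, hY⟩
  -- the velocities converge along the ultrafilter, hence so does the speed
  have hs : HasSpeed n τ a b ((edist (τ a) (τ b)).toReal / (b - a)) := by
    refine ⟨div_nonneg ENNReal.toReal_nonneg (sub_nonneg.2 hab.le), fun x₀ t ht hx ↦ ?_⟩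
    obtain ⟨Y, hY, hlim⟩ := exists_hasDerivWithinAt_spray_of_tendsto hσ hV hτ x₀ ht hx
    have hYt := hY.self_of_nhdsWithin ht
    rw [chartState_eq_of_hasDerivWithinAt hab ht (hY.mono fun _ h ↦ h.1) hYt.2]
    have hG : ContinuousAt (gram (n := n) x₀) (Y t).1 := by
      rw [hYt.1]
      exact (differentiableAt_gram x₀ ((extChartAt (𝓡 n) x₀).map_source hx)).continuousAt
    have h1 : Tendsto (fun i ↦ gram (n := n) x₀ (chartState x₀ (σ i) a b t).1) (Ultrafilter.of l)
        (𝓝 (gram x₀ (Y t).1)) :=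
      hG.tendsto.comp ((continuous_fst.tendsto _).comp hlim)
    have h2 : Tendsto (fun i ↦ (chartState (n := n) x₀ (σ i) a b t).2) (Ultrafilter.of l)
        (𝓝 (Y t).2) := (continuous_snd.tendsto _).comp hlim
    refine tendsto_nhds_unique (tendsto_bilin_apply_self h1 h2)
      ((hV.pow 2).congr' ?_)
    filter_upwards [hσ, (hτ t ht).eventually (extChartAt_source_mem_nhds' hx)] with i hi hxi
    exact (hi.2.gram_eq x₀ t ht hxi).symm
  refine ⟨hg, ?_⟩
  rw [hs.pathELength_eq hg]
  exact ((hd a ha b hb).trans (by rw [abs_of_nonneg (sub_nonneg.2 hab.le)])).symm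

end

section

variable {n : ℕ} {M : Type*} [EMetricSpace M] [ChartedSpace (EuclideanSpace ℝ (Fin n)) M]
  [RiemannianBundle (fun x : M ↦ TangentSpace (𝓡 n) x)] [IsManifold (𝓡 n) ∞ M]
  [IsContMDiffRiemannianBundle (𝓡 n) ∞ (EuclideanSpace ℝ (Fin n))
      (fun x : M ↦ TangentSpace (𝓡 n) x)]

/-! ### Uniqueness of geodesics and absence of corners -/

/-- Two geodesics with the same position and velocity at `s` agree on the right of `s`. -/
lemma eventually_eq_of_chartState_eq {γ₁ γ₂ : ℝ → M} {a₁ b₁ a₂ b₂ s : ℝ}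
    (h₁ : IsGeodesicSegment n γ₁ a₁ b₁) (h₂ : IsGeodesicSegment n γ₂ a₂ b₂)
    (hs₁ : s ∈ Ico a₁ b₁) (hs₂ : s ∈ Ico a₂ b₂) {x₀ : M}
    (hx : γ₁ s ∈ (extChartAt (𝓡 n) x₀).source) (heq : γ₁ s = γ₂ s)
    (hst : chartState (n := n) x₀ γ₁ a₁ b₁ s = chartState x₀ γ₂ a₂ b₂ s) :
    ∀ᶠ t in 𝓝[>] s, γ₁ t = γ₂ t := by
  have hT := (extChartAt (𝓡 n) x₀).map_source hx
  have hO := (isOpen_extChartAt_target (I := 𝓡 n) x₀).prod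
    (isOpen_univ (X := EuclideanSpace ℝ (Fin n)))
  obtain ⟨L, N, hN, hL⟩ := ((contDiffOn_spray_gram (n := n) x₀).contDiffAt
    (hO.mem_nhds (show chartState x₀ γ₁ a₁ b₁ s ∈ _ from ⟨hT, mem_univ _⟩))).exists_lipschitzOnWith
  have key {γ : ℝ → M} {a b : ℝ} (h : IsGeodesicSegment n γ a b) (hs : s ∈ Ico a b)
      (hxs : γ s ∈ (extChartAt (𝓡 n) x₀).source)
      (hNs : N ∈ 𝓝 (chartState (n := n) x₀ γ a b s)) :
      ∀ᶠ t in 𝓝[≥] s, t ∈ Ico a b ∧ γ t ∈ (extChartAt (𝓡 n) x₀).source ∧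
        chartState x₀ γ a b t ∈ N := by
    have hIcc : Icc a b ∈ 𝓝[≥] s :=
      mem_of_superset (Ico_mem_nhdsGE hs.2) fun t ht ↦ ⟨hs.1.trans ht.1, ht.2.le⟩
    have hle : 𝓝[≥] s ≤ 𝓝[Icc a b] s := nhdsWithin_le_of_mem hIcc
    have hs' := Ico_subset_Icc_self hs
    refine (eventually_of_mem (Ico_mem_nhdsGE hs.2) fun t ht ↦ ⟨hs.1.trans ht.1, ht.2⟩).and
      ((eventually_mem_extChartAt_source ((h.continuousOn s hs').mono_left hle) hxs).and ?_)
    exact ((h.hasDerivWithinAt_chartState x₀ hs' hxs).continuousWithinAt.mono_left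
      hle).eventually hNs
  obtain ⟨d, hd, hsub⟩ := mem_nhdsGE_iff_exists_Icc_subset.1
    ((key h₁ hs₁ hx hN).and (key h₂ hs₂ (heq ▸ hx) (hst ▸ hN)))
  have hder {γ : ℝ → M} {a b : ℝ} (h : IsGeodesicSegment n γ a b) {t : ℝ} (ht : t ∈ Ico a b)
      (hxt : γ t ∈ (extChartAt (𝓡 n) x₀).source) :
      HasDerivWithinAt (chartState (n := n) x₀ γ a b) (spray (gram x₀) (chartState x₀ γ a b t))
        (Ici t) t :=
    (h.hasDerivWithinAt_chartState x₀ (Ico_subset_Icc_self ht) hxt).mono_of_mem_nhdsWithin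
      (mem_of_superset (Ico_mem_nhdsGE ht.2) fun _ h ↦ ⟨ht.1.trans h.1, h.2.le⟩)
  have hcont {γ : ℝ → M} {a b : ℝ} (h : IsGeodesicSegment n γ a b)
      (hI : ∀ t ∈ Icc s d, t ∈ Ico a b ∧ γ t ∈ (extChartAt (𝓡 n) x₀).source ∧
        chartState (n := n) x₀ γ a b t ∈ N) :
      ContinuousOn (chartState (n := n) x₀ γ a b) (Icc s d) := fun t ht ↦
    (h.hasDerivWithinAt_chartState x₀ (Ico_subset_Icc_self (hI t ht).1)
      (hI t ht).2.1).continuousWithinAt.mono fun r hr ↦ Ico_subset_Icc_self (hI r hr).1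
  have hE := ODE_solution_unique_of_mem_Icc_right (v := fun _ ↦ spray (gram (n := n) x₀))
    (s := fun _ ↦ N) (fun _ _ ↦ hL) (hcont h₁ fun t ht ↦ (hsub ht).1)
    (fun t ht ↦ hder h₁ (hsub (Ico_subset_Icc_self ht)).1.1 (hsub (Ico_subset_Icc_self ht)).1.2.1)
    (fun t ht ↦ (hsub (Ico_subset_Icc_self ht)).1.2.2) (hcont h₂ fun t ht ↦ (hsub ht).2)
    (fun t ht ↦ hder h₂ (hsub (Ico_subset_Icc_self ht)).2.1 (hsub (Ico_subset_Icc_self ht)).2.2.1)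
    (fun t ht ↦ (hsub (Ico_subset_Icc_self ht)).2.2.2) hst
  filter_upwards [Ioc_mem_nhdsGT hd] with t ht
  have ht' := Ioc_subset_Icc_self ht
  exact (extChartAt (𝓡 n) x₀).injOn (hsub ht').1.2.1 (hsub ht').2.2.1 (congrArg Prod.fst (hE ht'))

omit [IsManifold (𝓡 n) ∞ M] [IsContMDiffRiemannianBundle (𝓡 n) ∞ (EuclideanSpace ℝ (Fin n))
      (fun x : M ↦ TangentSpace (𝓡 n) x)] in
lemma enorm_mfderiv_extChartAt_symm (x₀ : M) (y v : EuclideanSpace ℝ (Fin n)) :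
    ‖mfderiv 𝓘(ℝ, EuclideanSpace ℝ (Fin n)) (𝓡 n) (extChartAt (𝓡 n) x₀).symm y v‖ₑ =
      ENNReal.ofReal √(gram x₀ y v v) := by
  rw [← ofReal_norm, norm_eq_sqrt_real_inner]
  rfl

variable [IsRiemannianManifold (𝓡 n) M]

/-- Near a point of a chart, the distance is bounded, up to a small relative error, by the norm of
the coordinate difference for the metric frozen at that point. -/
lemma exists_ball_forall_edist_le (x₀ : M) {u₀ : EuclideanSpace ℝ (Fin n)}
    (hu₀ : u₀ ∈ (extChartAt (𝓡 n) x₀).target) {η : ℝ} (hη : 0 < η) :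
    ∃ r > 0, ∀ y ∈ Metric.ball u₀ r, ∀ z ∈ Metric.ball u₀ r,
      edist ((extChartAt (𝓡 n) x₀).symm y) ((extChartAt (𝓡 n) x₀).symm z) ≤
        ENNReal.ofReal √(gram x₀ u₀ (z - y) (z - y) + η * ‖z - y‖ ^ 2) := by
  have hT := isOpen_extChartAt_target (I := 𝓡 n) x₀
  obtain ⟨r, hr, hsub⟩ := Metric.mem_nhds_iff.1 (inter_mem (hT.mem_nhds hu₀)
    ((differentiableAt_gram x₀ hu₀).continuousAt.preimage_mem_nhds
      (Metric.closedBall_mem_nhds _ hη)))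
  refine ⟨r, hr, fun y hy z hz ↦ ?_⟩
  have hseg : ∀ t ∈ Icc (0 : ℝ) 1, ContinuousAffineMap.lineMap (R := ℝ) y z t ∈ Metric.ball u₀ r :=
    fun t ht ↦ (convex_ball u₀ r).segment_subset hy hz (by
      rw [segment_eq_image_lineMap]; exact ⟨t, ht, rfl⟩)
  set c : ℝ → EuclideanSpace ℝ (Fin n) := fun t ↦ ContinuousAffineMap.lineMap (R := ℝ) y z t with hc
  set γ : ℝ → M := (extChartAt (𝓡 n) x₀).symm ∘ c with hγ
  have hcs : ContMDiffOn 𝓘(ℝ, ℝ) 𝓘(ℝ, EuclideanSpace ℝ (Fin n)) 1 c (Icc 0 1) :=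
    (contMDiff_iff_contDiff.2 (ContinuousAffineMap.contDiff _)).contMDiffOn
  rw [IsRiemannianManifold.out (I := 𝓡 n) ((extChartAt (𝓡 n) x₀).symm y)]
  refine (Manifold.riemannianEDist_le_pathELength (γ := γ) (a := 0) (b := 1)
    ((contMDiffOn_extChartAt_symm x₀).comp hcs fun t ht ↦ (hsub (hseg t ht)).1)
    (by simp [γ, c, ContinuousAffineMap.coe_lineMap_eq])
    (by simp [γ, c, ContinuousAffineMap.coe_lineMap_eq]) zero_le_one).trans ?_
  rw [Manifold.pathELength_eq_lintegral_mfderivWithin_Icc]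
  refine (MeasureTheory.setLIntegral_mono' measurableSet_Icc (g := fun _ ↦
    ENNReal.ofReal √(gram x₀ u₀ (z - y) (z - y) + η * ‖z - y‖ ^ 2)) fun t ht ↦ ?_).trans_eq
      (by simp)
  obtain ⟨h1, h2⟩ := hsub (hseg t ht)
  have hφ := mdifferentiableWithinAt_extChartAt_symm (I := 𝓡 n) h1
  rw [ModelWithCorners.Boundaryless.range_eq_univ, mdifferentiableWithinAt_univ] at hφ
  have hcd : HasDerivWithinAt c (z - y) (Icc 0 1) t := by
    simpa [c, ContinuousAffineMap.coe_lineMap_eq] using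
      (AffineMap.hasDerivWithinAt_lineMap (a := y) (b := z) (s := Icc 0 1) (x := t))
  have hm := hφ.hasMFDerivAt.comp_hasMFDerivWithinAt t hcd.hasFDerivWithinAt.hasMFDerivWithinAt
  have e : mfderivWithin 𝓘(ℝ, ℝ) (𝓡 n) γ (Icc 0 1) t (1 : ℝ) =
      mfderiv 𝓘(ℝ, EuclideanSpace ℝ (Fin n)) (𝓡 n) (extChartAt (𝓡 n) x₀).symm (c t) (z - y) := by
    rw [hm.mfderivWithin (uniqueDiffOn_Icc zero_lt_one t ht).uniqueMDiffWithinAt]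
    exact congrArg (mfderiv 𝓘(ℝ, EuclideanSpace ℝ (Fin n)) (𝓡 n) (extChartAt (𝓡 n) x₀).symm (c t))
      (one_smul ℝ (z - y))
  refine ((congrArg (‖·‖ₑ) e).trans (enorm_mfderiv_extChartAt_symm x₀ (c t) (z - y))).trans_le ?_
  gcongr
  have h3 : ‖gram x₀ (c t) - gram x₀ u₀‖ ≤ η := by simpa [dist_eq_norm] using h2
  have h4 : (gram x₀ (c t) - gram x₀ u₀) (z - y) (z - y) ≤ η * ‖z - y‖ ^ 2 := by
    refine (Real.le_norm_self _).trans (((gram x₀ (c t) - gram x₀ u₀).le_opNorm₂ _ _).trans ?_)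
    rw [mul_assoc, ← pow_two]
    gcongr
  simp only [sub_apply] at h4
  linarith

/-- A concatenation of two geodesics of the same speed which is minimizing near the junction has no
corner there. Otherwise a straight segment in a chart would cut the corner: it would yield
`2 v ≤ |v₁ + v₂|` for vectors of norm `v`, which forces `v₁ = v₂` by strict convexity. -/
lemma chartState_eq_of_edist_ge {γ₁ γ₂ : ℝ → M} {a₁ b₁ a₂ b₂ s v : ℝ}
    (h₁ : IsGeodesicSegment n γ₁ a₁ b₁) (h₂ : IsGeodesicSegment n γ₂ a₂ b₂)
    (hv₁ : HasSpeed n γ₁ a₁ b₁ v) (hv₂ : HasSpeed n γ₂ a₂ b₂ v)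
    (hs₁ : s ∈ Ioc a₁ b₁) (hs₂ : s ∈ Ico a₂ b₂) {x₀ : M}
    (hx : γ₁ s ∈ (extChartAt (𝓡 n) x₀).source) (heq : γ₁ s = γ₂ s)
    (hd : ∀ᶠ h in 𝓝[>] (0 : ℝ), ENNReal.ofReal (2 * v * h) ≤ edist (γ₁ (s - h)) (γ₂ (s + h))) :
    chartState (n := n) x₀ γ₁ a₁ b₁ s = chartState x₀ γ₂ a₂ b₂ s := by
  have hT := (extChartAt (𝓡 n) x₀).map_source hx
  have hx₂ : γ₂ s ∈ (extChartAt (𝓡 n) x₀).source := heq ▸ hx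
  set φ := extChartAt (𝓡 n) x₀ with hφ
  set u₀ := φ (γ₁ s) with hu₀
  set V₁ := (chartState (n := n) x₀ γ₁ a₁ b₁ s).2 with hV₁
  set V₂ := (chartState (n := n) x₀ γ₂ a₂ b₂ s).2 with hV₂
  have hs₁' := Ioc_subset_Icc_self hs₁
  have hs₂' := Ico_subset_Icc_self hs₂
  have g₁ : gram x₀ u₀ V₁ V₁ = v ^ 2 := hv₁.gram_eq x₀ s hs₁' hx
  have g₂ : gram x₀ u₀ V₂ V₂ = v ^ 2 := by
    rw [hu₀, heq]; exact hv₂.gram_eq x₀ s hs₂' hx₂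
  have c₁ : Tendsto (fun h : ℝ ↦ s - h) (𝓝[>] 0) (𝓝[Icc a₁ b₁ \ {s}] s) := by
    have h0 : Tendsto (fun h : ℝ ↦ s - h) (𝓝 0) (𝓝 s) := by
      simpa using (continuous_sub_left s).tendsto 0
    refine tendsto_nhdsWithin_iff.2 ⟨h0.mono_left nhdsWithin_le_nhds, ?_⟩
    filter_upwards [Ioo_mem_nhdsGT (sub_pos.2 hs₁.1)] with h hh
    exact ⟨⟨by linarith [hh.2], by linarith [hh.1, hs₁.2]⟩, by simpa using hh.1.ne'⟩
  have c₂ : Tendsto (fun h : ℝ ↦ s + h) (𝓝[>] 0) (𝓝[Icc a₂ b₂ \ {s}] s) := by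
    have h0 : Tendsto (fun h : ℝ ↦ s + h) (𝓝 0) (𝓝 s) := by
      simpa using (continuous_const_add s).tendsto 0
    refine tendsto_nhdsWithin_iff.2 ⟨h0.mono_left nhdsWithin_le_nhds, ?_⟩
    filter_upwards [Ioo_mem_nhdsGT (sub_pos.2 hs₂.2)] with h hh
    exact ⟨⟨by linarith [hh.1, hs₂.1], by linarith [hh.2]⟩, by simpa using hh.1.ne'⟩
  have d₁ := hasDerivWithinAt_fst (h₁.hasDerivWithinAt_chartState x₀ hs₁' hx)
  have d₂ := hasDerivWithinAt_fst (h₂.hasDerivWithinAt_chartState x₀ hs₂' hx₂)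
  -- the difference quotients of the coordinate difference across the junction
  set ξ : ℝ → EuclideanSpace ℝ (Fin n) := fun h ↦ h⁻¹ • (φ (γ₂ (s + h)) - φ (γ₁ (s - h))) with hξ
  have hξlim : Tendsto ξ (𝓝[>] 0) (𝓝 (V₁ + V₂)) := by
    refine (((hasDerivWithinAt_iff_tendsto_slope.1 d₁).comp c₁).add
      ((hasDerivWithinAt_iff_tendsto_slope.1 d₂).comp c₂)).congr fun h ↦ ?_
    simp only [Function.comp, slope, vsub_eq_sub, chartState, hξ, ← heq, ← hφ]
    rw [sub_sub_cancel_left, add_sub_cancel_left, inv_neg, neg_smul, ← smul_neg, ← smul_add]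
    congr 1
    abel
  have hle : Icc a₁ b₁ \ {s} ⊆ Icc a₁ b₁ := sdiff_subset
  have hle₂ : Icc a₂ b₂ \ {s} ⊆ Icc a₂ b₂ := sdiff_subset
  have hbound (η : ℝ) (hη : 0 < η) :
      (2 * v) ^ 2 ≤ gram x₀ u₀ (V₁ + V₂) (V₁ + V₂) + η * ‖V₁ + V₂‖ ^ 2 := by
    obtain ⟨r, hr, hball⟩ := exists_ball_forall_edist_le x₀ hT hη
    have e₁ := c₁.mono_right (nhdsWithin_mono s hle)
    have e₂ := c₂.mono_right (nhdsWithin_mono s hle₂)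
    have hlim : Tendsto (fun h ↦ gram x₀ u₀ (ξ h) (ξ h) + η * ‖ξ h‖ ^ 2) (𝓝[>] 0)
        (𝓝 (gram x₀ u₀ (V₁ + V₂) (V₁ + V₂) + η * ‖V₁ + V₂‖ ^ 2)) :=
      (tendsto_bilin_apply_self tendsto_const_nhds hξlim).add ((hξlim.norm.pow 2).const_mul η)
    refine ge_of_tendsto hlim ?_
    filter_upwards [hd, self_mem_nhdsWithin,
      e₁.eventually (eventually_mem_extChartAt_source (h₁.continuousOn s hs₁') hx),
      e₂.eventually (eventually_mem_extChartAt_source (h₂.continuousOn s hs₂') hx₂),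
      e₁.eventually (d₁.continuousWithinAt.eventually (Metric.ball_mem_nhds _ hr)),
      e₂.eventually (d₂.continuousWithinAt.eventually (Metric.ball_mem_nhds _ hr))]
      with h hdh hh0 hx1 hx2 hb1 hb2
    have hh : (0 : ℝ) < h := hh0
    have hb1' : φ (γ₁ (s - h)) ∈ Metric.ball u₀ r := hb1
    have hb2' : φ (γ₂ (s + h)) ∈ Metric.ball u₀ r := by
      rw [hu₀, heq]; exact hb2
    have h3 := hball _ hb1' _ hb2'
    rw [← hφ, φ.left_inv hx1, φ.left_inv hx2] at h3
    replace h3 := (ENNReal.ofReal_le_ofReal_iff (Real.sqrt_nonneg _)).1 (hdh.trans h3)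
    rw [Real.le_sqrt (mul_nonneg (mul_nonneg zero_le_two hv₁.nonneg) hh.le)
      (add_nonneg (gram_self_nonneg _ _ _) (by positivity))] at h3
    have h4 : φ (γ₂ (s + h)) - φ (γ₁ (s - h)) = h • ξ h := by
      simp only [hξ, smul_smul, mul_inv_cancel₀ hh.ne', one_smul]
    rw [h4, norm_smul, Real.norm_of_nonneg hh.le] at h3
    simp only [map_smul, smul_apply, smul_eq_mul] at h3
    refine le_of_mul_le_mul_right ?_ (pow_pos hh 2)
    linarith
  have hlow : (2 * v) ^ 2 ≤ gram x₀ u₀ (V₁ + V₂) (V₁ + V₂) := by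
    have hlim : Tendsto (fun η : ℝ ↦ gram x₀ u₀ (V₁ + V₂) (V₁ + V₂) + η * ‖V₁ + V₂‖ ^ 2) (𝓝[>] 0)
        (𝓝 (gram x₀ u₀ (V₁ + V₂) (V₁ + V₂) + 0 * ‖V₁ + V₂‖ ^ 2)) :=
      (Continuous.tendsto (by fun_prop) 0).mono_left nhdsWithin_le_nhds
    rw [zero_mul, add_zero] at hlim
    exact ge_of_tendsto hlim (eventually_of_mem self_mem_nhdsWithin hbound)
  refine Prod.ext (congrArg φ heq) ?_
  by_contra hne
  have hpos := gram_self_pos x₀ hT (sub_ne_zero.2 hne : V₁ - V₂ ≠ 0)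
  simp only [map_sub, map_add, add_apply, sub_apply, g₁, g₂] at hpos hlow
  linarith

end

section

/-! ### Compactness from cluster points -/

section Compactness

variable {X ι : Type*} [EMetricSpace X]

lemma tendsto_of_edist_tendsto_zero {l : Filter ι} {f g : ι → X} {z : X}
    (h : Tendsto (fun i ↦ edist (f i) (g i)) l (𝓝 0)) (hg : Tendsto g l (𝓝 z)) :
    Tendsto f l (𝓝 z) := by
  rw [tendsto_iff_edist_tendsto_0] at hg ⊢
  refine tendsto_of_tendsto_of_tendsto_of_le_of_le tendsto_const_nhds (by simpa using h.add hg)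
    (fun _ ↦ zero_le) fun i ↦ edist_triangle _ _ _

lemma isCompact_closure_of_forall_mapClusterPt {S : Set X}
    (h : ∀ y : ℕ → X, (∀ k, y k ∈ S) → ∃ z, MapClusterPt z atTop y) : IsCompact (closure S) := by
  rw [isCompact_iff_isSeqCompact]
  intro x hx
  choose y hyS hy using fun k ↦
    EMetric.mem_closure_iff.1 (hx k) (k : ENNReal)⁻¹ (ENNReal.inv_pos.2 (ENNReal.natCast_ne_top k))
  obtain ⟨z, hz⟩ := h y hyS
  obtain ⟨φ, hφ, hlim⟩ := hz.tendsto_subseq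
  refine ⟨z, mem_closure_of_tendsto hlim (Eventually.of_forall fun k ↦ hyS _), φ, hφ,
    tendsto_of_edist_tendsto_zero ?_ hlim⟩
  exact (tendsto_of_tendsto_of_tendsto_of_le_of_le tendsto_const_nhds
    ENNReal.tendsto_inv_nat_nhds_zero (fun _ ↦ zero_le) fun k ↦ (hy k).le).comp hφ.tendsto_atTop

end Compactness

variable {n : ℕ} {M : Type*} [EMetricSpace M] [ChartedSpace (EuclideanSpace ℝ (Fin n)) M]
  [RiemannianBundle (fun x : M ↦ TangentSpace (𝓡 n) x)] [IsManifold (𝓡 n) ∞ M]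
  [IsContMDiffRiemannianBundle (𝓡 n) ∞ (EuclideanSpace ℝ (Fin n))
      (fun x : M ↦ TangentSpace (𝓡 n) x)]

lemma IsMinimizingGeodesic.hasSpeed_of_edist_eq {γ : ℝ → M} {a b v : ℝ}
    (h : IsMinimizingGeodesic n γ a b) (hv : 0 ≤ v)
    (hd : edist (γ a) (γ b) = ENNReal.ofReal (v * (b - a))) : HasSpeed n γ a b v := by
  have hab := sub_pos.2 h.isGeodesicSegment.lt
  convert h.hasSpeed
  rw [hd, ENNReal.toReal_ofReal (by positivity), mul_div_cancel_right₀ _ hab.ne']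

/-- The affine reparametrization on `[0, 1]` of a minimizing geodesic. -/
lemma IsMinimizingGeodesic.comp_lineMap {γ : ℝ → M} {a b : ℝ} (h : IsMinimizingGeodesic n γ a b) :
    IsMinimizingGeodesic n (fun t ↦ γ (AffineMap.lineMap a b t)) 0 1 := by
  simp only [AffineMap.lineMap_apply_ring']
  simp only [mul_comm _ (b - a)]
  exact h.comp_affine zero_lt_one (sub_nonneg.2 h.isGeodesicSegment.lt.le) (by ring) (by ring)

variable [IsRiemannianManifold (𝓡 n) M]

/-! ### Pointwise and uniform convergence of minimizing geodesics -/

variable {ι : Type*} {l : Filter ι} {σ : ι → ℝ → M} {τ : ℝ → M} {a b : ℝ}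

lemma IsMinimizingGeodesic.edist_left_le {γ : ℝ → M} (h : IsMinimizingGeodesic n γ a b) {t : ℝ}
    (ht : t ∈ Icc a b) : edist (γ t) (γ a) ≤ edist (γ a) (γ b) := by
  have hab := h.isGeodesicSegment.lt.le
  obtain ⟨v, hv⟩ := h.isGeodesicSegment.exists_hasSpeed
  rw [edist_comm, h.edist_eq hv (left_mem_Icc.2 hab) ht,
    h.edist_eq hv (left_mem_Icc.2 hab) (right_mem_Icc.2 hab), abs_of_nonneg (sub_nonneg.2 ht.1),
    abs_of_nonneg (sub_nonneg.2 hab)]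
  exact ENNReal.ofReal_le_ofReal (mul_le_mul_of_nonneg_left (by linarith [ht.2]) hv.nonneg)

/-- Minimizing geodesics of bounded speed are equi-Lipschitz. Hence if they converge at a time `t₀`
to a curve of the limiting speed, they are close to it at all times near `t₀`. -/
lemma exists_forall_eventually_edist_lt [l.NeBot] {V : ι → ℝ} {v : ℝ}
    (hσ : ∀ᶠ i in l, IsMinimizingGeodesic n (σ i) a b ∧ HasSpeed n (σ i) a b (V i))
    (hV : Tendsto V l (𝓝 v)) {J : Set ℝ} (hJ : J ⊆ Icc a b)
    (hτ : ∀ s ∈ J, ∀ t ∈ J, edist (τ s) (τ t) = ENNReal.ofReal (v * |t - s|))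
    {ε : ENNReal} (hε : 0 < ε) :
    ∃ δ > 0, ∀ t₀ ∈ J, Tendsto (fun i ↦ σ i t₀) l (𝓝 (τ t₀)) →
      ∀ᶠ i in l, ∀ t ∈ J, |t - t₀| ≤ δ → edist (τ t) (σ i t) < ε := by
  have hv0 : 0 ≤ v := ge_of_tendsto hV (hσ.mono fun i h ↦ h.2.nonneg)
  have hε3 : 0 < ε / 3 := ENNReal.div_pos hε.ne' (by simp)
  obtain ⟨δ, hδ, hδε⟩ := exists_pos_ofReal_mul_lt (v + 1) hε3
  refine ⟨δ, hδ, fun t₀ ht₀ hlim ↦ ?_⟩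
  filter_upwards [hσ, hV.eventually (ge_mem_nhds (lt_add_one v)),
    hlim.eventually (Metric.eball_mem_nhds _ hε3)] with i hi hVi hti t ht htδ
  refine (edist_triangle4 _ (τ t₀) (σ i t₀) _).trans_lt ?_
  rw [← ENNReal.add_thirds ε]
  refine ENNReal.add_lt_add (ENNReal.add_lt_add ?_ ?_) ?_
  · rw [edist_comm, hτ t₀ ht₀ t ht]
    exact (ENNReal.ofReal_le_ofReal
      (mul_le_mul (by linarith) htδ (abs_nonneg _) (by positivity))).trans_lt hδε
  · rw [edist_comm]
    exact hti
  · rw [hi.1.edist_eq hi.2 (hJ ht₀) (hJ ht)]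
    exact (ENNReal.ofReal_le_ofReal
      (mul_le_mul hVi htδ (abs_nonneg _) (by positivity))).trans_lt hδε

lemma IsMinimizingGeodesic.tendstoUniformlyOn [l.NeBot] (hab : a < b)
    (hσ : ∀ᶠ i in l, IsMinimizingGeodesic n (σ i) a b)
    (hτ : ∀ t ∈ Icc a b, Tendsto (fun i ↦ σ i t) l (𝓝 (τ t))) :
    TendstoUniformlyOn σ τ l (Icc a b) := by
  have hV := tendsto_speed hσ (hτ a (left_mem_Icc.2 hab.le)) (hτ b (right_mem_Icc.2 hab.le))
  replace hσ := hσ.mono fun i h ↦ And.intro h h.hasSpeed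
  have hd (s) (hs : s ∈ Icc a b) (t) (ht : t ∈ Icc a b) :=
    edist_eq_of_tendsto hσ hV hs ht (hτ s hs) (hτ t ht)
  rw [← tendstoLocallyUniformlyOn_iff_tendstoUniformlyOn_of_compact isCompact_Icc,
    EMetric.tendstoLocallyUniformlyOn_iff]
  intro ε hε t₀ ht₀
  obtain ⟨δ, hδ, h⟩ := exists_forall_eventually_edist_lt hσ hV subset_rfl hd hε
  exact ⟨_, inter_mem_nhdsWithin _ (Metric.closedBall_mem_nhds t₀ hδ),
    (h t₀ ht₀ (hτ t₀ ht₀)).mono fun i hi t ht ↦ hi t ht.1 ht.2⟩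

/-- If minimizing geodesics converge along an ultrafilter at one time, then they do so at all nearby
times, by local compactness. -/
lemma exists_forall_exists_tendsto {U : Ultrafilter ι} {V : ι → ℝ} {v : ℝ}
    (hσ : ∀ᶠ i in U, IsMinimizingGeodesic n (σ i) a b ∧ HasSpeed n (σ i) a b (V i))
    (hV : Tendsto V U (𝓝 v)) {s : ℝ} (hs : s ∈ Icc a b) {x : M}
    (hx : Tendsto (fun i ↦ σ i s) U (𝓝 x)) :
    ∃ δ > 0, ∀ t ∈ Icc a b, |t - s| ≤ δ → ∃ y, Tendsto (fun i ↦ σ i t) U (𝓝 y) := by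
  have hv0 : 0 ≤ v := ge_of_tendsto hV (hσ.mono fun i h ↦ h.2.nonneg)
  have := Manifold.locallyCompact_of_finiteDimensional (M := M) (𝓡 n)
  obtain ⟨K, hK, hKx⟩ := exists_compact_mem_nhds x
  obtain ⟨ρ, hρ, hρK⟩ := EMetric.mem_nhds_iff.1 hKx
  obtain ⟨δ, hδ, hδρ⟩ := exists_pos_ofReal_mul_lt (v + 1) (ENNReal.half_pos hρ.ne')
  refine ⟨δ, hδ, fun t ht hts ↦ ?_⟩
  have hmem : ∀ᶠ i in U, σ i t ∈ K := by
    filter_upwards [hσ, hV.eventually (ge_mem_nhds (lt_add_one v)),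
      hx.eventually (Metric.eball_mem_nhds _ (ENNReal.half_pos hρ.ne'))] with i hi hVi hxi
    refine hρK ((edist_triangle _ (σ i s) _).trans_lt ?_)
    rw [← ENNReal.add_halves ρ]
    refine ENNReal.add_lt_add (lt_of_le_of_lt ?_ hδρ) hxi
    rw [edist_comm, hi.1.edist_eq hi.2 hs ht]
    exact ENNReal.ofReal_le_ofReal (mul_le_mul hVi hts (abs_nonneg _) (by positivity))
  obtain ⟨y, -, hy⟩ := hK.ultrafilter_le_nhds (U.map fun i ↦ σ i t) (le_principal_iff.2 hmem)
  exact ⟨y, hy⟩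

/-! ### Limit segments and pseudoconvexity -/

omit [IsRiemannianManifold (𝓡 n) M] in
/-- Minimal pseudoconvexity is a compactness property of sequences of points on minimizing
geodesics with converging endpoints. -/
lemma isMinimallyPseudoconvex_of_forall_mapClusterPt
    (h : ∀ (p q : M) (t : ℝ) (σ : ℕ → ℝ → M) (s : ℕ → ℝ),
      (∀ k, IsMinimizingGeodesic n (σ k) 0 1) → Tendsto (fun k ↦ σ k 0) atTop (𝓝 p) →
      Tendsto (fun k ↦ σ k 1) atTop (𝓝 q) → (∀ k, s k ∈ Icc (0 : ℝ) 1) → t ∈ Icc (0 : ℝ) 1 →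
      Tendsto s atTop (𝓝 t) → ∃ z, MapClusterPt z atTop fun k ↦ σ k (s k)) :
    IsMinimallyPseudoconvex n M := by
  intro C hC
  set S : Set M := {x | ∃ γ : ℝ → M, IsMinimizingGeodesic n γ 0 1 ∧ γ 0 ∈ C ∧ γ 1 ∈ C ∧
    ∃ t ∈ Icc (0 : ℝ) 1, γ t = x} with hS
  refine ⟨closure S, isCompact_closure_of_forall_mapClusterPt fun y hy ↦ ?_, ?_⟩
  · choose σ hσ h0 h1 s hs hy using hy
    obtain ⟨⟨p, q, t⟩, hz, φ, hφ, hlim⟩ := (hC.prod (hC.prod isCompact_Icc)).tendsto_subseq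
      (x := fun k ↦ (σ k 0, σ k 1, s k)) fun k ↦ ⟨h0 k, h1 k, hs k⟩
    rw [nhds_prod_eq, nhds_prod_eq] at hlim
    obtain ⟨z, hz⟩ := h p q t (fun k ↦ σ (φ k)) (s ∘ φ) (fun k ↦ hσ _)
      (tendsto_fst.comp hlim) (tendsto_fst.comp (tendsto_snd.comp hlim)) (fun k ↦ hs _) hz.2.2
      (tendsto_snd.comp (tendsto_snd.comp hlim))
    refine ⟨z, MapClusterPt.of_comp hφ.tendsto_atTop ?_⟩
    simpa only [Function.comp_def, hy] using hz
  · rintro a b γ hγ ha hb _ ⟨t, ht, rfl⟩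
    have hab := hγ.isGeodesicSegment.lt
    refine subset_closure ⟨_, hγ.comp_lineMap, by simpa using ha, by simpa using hb,
      (t - a) / (b - a), ⟨div_nonneg (sub_nonneg.2 ht.1) (sub_nonneg.2 hab.le),
      (div_le_one (sub_pos.2 hab)).2 (by linarith [ht.2])⟩, ?_⟩
    rw [AffineMap.lineMap_apply_ring', div_mul_cancel₀ _ (sub_pos.2 hab).ne', sub_add_cancel]

/-- Points on minimizing geodesics with converging endpoints have a cluster point: if the endpoints
have the same limit, the geodesics shrink to it, and otherwise there is a limit segment. -/
lemma HasMinimalLGS.isMinimallyPseudoconvex (h : HasMinimalLGS n M) :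
    IsMinimallyPseudoconvex n M := by
  refine isMinimallyPseudoconvex_of_forall_mapClusterPt fun p q t σ s hσ hp hq hs ht hst ↦ ?_
  by_cases hqp : q = p
  · subst hqp
    refine ⟨q, (tendsto_of_edist_tendsto_zero ?_ hp).mapClusterPt⟩
    have := hp.edist hq
    rw [edist_self] at this
    exact tendsto_of_tendsto_of_tendsto_of_le_of_le tendsto_const_nhds this (fun _ ↦ zero_le)
      fun k ↦ (hσ k).edist_left_le (hs k)
  · obtain ⟨φ, τ, hφ, hτ, -, -, hu⟩ := h p q (fun _ ↦ 0) (fun _ ↦ 1) σ hqp hσ hp hq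
    simp only [AffineMap.lineMap_apply_ring', sub_zero, mul_one, add_zero] at hu
    refine ⟨τ t, MapClusterPt.of_comp hφ.tendsto_atTop (Tendsto.mapClusterPt ?_)⟩
    exact hu.tendsto_comp (hτ.isGeodesicSegment.continuousOn t ht)
      (tendsto_nhdsWithin_iff.2 ⟨hst.comp hφ.tendsto_atTop, Eventually.of_forall fun k ↦ hs _⟩)

/-- The geodesics stay in a compact set, hence converge along an ultrafilter, uniformly. A
subsequence is then extracted by choosing, for each precision, an index where it is attained. -/
lemma IsMinimallyPseudoconvex.hasMinimalLGS (h : IsMinimallyPseudoconvex n M) :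
    HasMinimalLGS n M := by
  intro p q a b σ _ hσ hp hq
  obtain ⟨C', hC', hsub⟩ := h _ (hp.isCompact_insert_range.union hq.isCompact_insert_range)
  set F : ℕ → ℝ → M := fun k t ↦ σ k (AffineMap.lineMap (a k) (b k) t) with hF
  have hFm (k) : IsMinimizingGeodesic n (F k) 0 1 := (hσ k).comp_lineMap
  have hmem (k) (t) (ht : t ∈ Icc (0 : ℝ) 1) : F k t ∈ C' :=
    hsub 0 1 (F k) (hFm k)
      (Or.inl (mem_insert_of_mem _ ⟨k, by simp [hF]⟩))
      (Or.inr (mem_insert_of_mem _ ⟨k, by simp [hF]⟩)) (mem_image_of_mem _ ht)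
  set U : Ultrafilter ℕ := hyperfilter ℕ
  have hU : (U : Filter ℕ) ≤ atTop := Nat.hyperfilter_le_atTop
  have hlim : ∀ t ∈ Icc (0 : ℝ) 1, ∃ x, Tendsto (fun k ↦ F k t) U (𝓝 x) := fun t ht ↦ by
    obtain ⟨x, -, hx⟩ := hC'.ultrafilter_le_nhds (U.map fun k ↦ F k t)
      (le_principal_iff.2 (show ∀ᶠ k in (U : Filter ℕ), F k t ∈ C' from
        .of_forall fun k ↦ hmem k t ht))
    exact ⟨x, hx⟩
  have : Nonempty M := ⟨p⟩
  choose! τ hτ using hlim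
  have hFU := Eventually.of_forall (f := (U : Filter ℕ)) hFm
  have hu := IsMinimizingGeodesic.tendstoUniformlyOn zero_lt_one hFU hτ
  obtain ⟨φ, hφ, hφu⟩ := extraction_forall_of_frequently
    (P := fun m k ↦ ∀ t ∈ Icc (0 : ℝ) 1, edist (τ t) (F k t) < (m : ENNReal)⁻¹) fun m ↦
    (EMetric.tendstoUniformlyOn_iff.1 hu _
      (ENNReal.inv_pos.2 (ENNReal.natCast_ne_top m))).frequently.filter_mono hU
  refine ⟨φ, τ, hφ, .of_tendsto zero_lt_one hFU hτ, ?_, ?_, ?_⟩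
  · refine tendsto_nhds_unique (hτ 0 (by simp)) ?_
    simpa [hF] using hp.mono_left hU
  · refine tendsto_nhds_unique (hτ 1 (by simp)) ?_
    simpa [hF] using hq.mono_left hU
  · refine EMetric.tendstoUniformlyOn_iff.2 fun ε hε ↦ ?_
    filter_upwards [ENNReal.tendsto_inv_nat_nhds_zero.eventually (gt_mem_nhds hε)] with m hm t ht
    exact (hφu m t ht).trans hm

/-! ### Convex manifolds -/

/-- In a convex manifold, minimizing geodesics with converging endpoints converge at all times along
an ultrafilter. They converge on a short interval by local compactness; a minimizing geodesic from
the limit at time `ε` to the limit `q` of the endpoints extends the limit curve up to `q`, and the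
convergence propagates along it: near a time where the geodesics converge to it, their limit
followed by this geodesic is minimizing, hence has no corner. -/
lemma IsConvexManifold.exists_tendsto (hM : IsConvexManifold n M) {U : Ultrafilter ι}
    (hσ : ∀ᶠ i in U, IsMinimizingGeodesic n (σ i) 0 1) {p q : M}
    (hp : Tendsto (fun i ↦ σ i 0) U (𝓝 p)) (hq : Tendsto (fun i ↦ σ i 1) U (𝓝 q))
    {t : ℝ} (ht : t ∈ Icc (0 : ℝ) 1) : ∃ x, Tendsto (fun i ↦ σ i t) U (𝓝 x) := by
  have h0 : (0 : ℝ) ∈ Icc (0 : ℝ) 1 := by simp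
  have h1 : (1 : ℝ) ∈ Icc (0 : ℝ) 1 := by simp
  have hV := tendsto_speed hσ hp hq
  replace hσ := hσ.mono fun i h ↦ And.intro h h.hasSpeed
  set v := (edist p q).toReal / (1 - 0) with hv
  have hv0 : 0 ≤ v := by positivity
  obtain ⟨δ₀, hδ₀, hδ₀lim⟩ := exists_forall_exists_tendsto hσ hV h0 hp
  set ε := min δ₀ (1 / 2) with hε
  have hε0 : 0 < ε := lt_min hδ₀ (by norm_num)
  have hε1 : ε < 1 := (min_le_right _ _).trans_lt (by norm_num)
  have hsmall : ∀ s ∈ Icc 0 ε, ∃ x, Tendsto (fun i ↦ σ i s) U (𝓝 x) := fun s hs ↦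
    hδ₀lim s ⟨hs.1, hs.2.trans hε1.le⟩ (by
      rw [sub_zero, abs_of_nonneg hs.1]; exact hs.2.trans (min_le_left _ _))
  rcases le_total t ε with htε | htε
  · exact hsmall t ⟨ht.1, htε⟩
  obtain ⟨m, hm⟩ := hsmall ε (right_mem_Icc.2 hε0.le)
  have hεI : ε ∈ Icc (0 : ℝ) 1 := ⟨hε0.le, hε1.le⟩
  obtain ⟨a, b, γ, hγ, hγa, hγb⟩ := hM m q
  -- a minimizing geodesic `c` from `m` to `q`, parametrized on `[ε, 1]`
  obtain ⟨c, hc, hcε, hc1⟩ : ∃ c : ℝ → M, IsMinimizingGeodesic n c ε 1 ∧ c ε = m ∧ c 1 = q := by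
    have hab := hγ.isGeodesicSegment.lt
    have h1ε : 1 - ε ≠ 0 := (sub_pos.2 hε1).ne'
    have e1 : (b - a) / (1 - ε) * ε + (a - (b - a) / (1 - ε) * ε) = a := by ring
    have e2 : (b - a) / (1 - ε) * 1 + (a - (b - a) / (1 - ε) * ε) = b := by
      field_simp
      ring
    refine ⟨_, hγ.comp_affine hε1 (div_nonneg (sub_nonneg.2 hab.le) (sub_nonneg.2 hε1.le)) e1 e2,
      ?_, ?_⟩
    · simp only [e1, hγa]
    · simp only [e2, hγb]
  have hcv : HasSpeed n c ε 1 v := hc.hasSpeed_of_edist_eq hv0 (by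
    rw [hcε, hc1, edist_eq_of_tendsto hσ hV hεI h1 hm hq, abs_of_nonneg (sub_nonneg.2 hε1.le)])
  have hcd (s) (hs : s ∈ Icc ε 1) (r) (hr : r ∈ Icc ε 1) := hc.edist_eq hcv hs hr
  have hsub : Icc ε 1 ⊆ Icc (0 : ℝ) 1 := Icc_subset_Icc_left hε0.le
  suffices hS : Icc ε 1 ⊆ {s | Tendsto (fun i ↦ σ i s) U (𝓝 (c s))} from ⟨_, hS ⟨htε, ht.2⟩⟩
  refine IsClosed.Icc_subset_of_forall_mem_nhdsWithin ?_ (by simpa [hcε] using hm) ?_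
  · -- convergence to `c` is a closed condition, since the `σ i` are equi-Lipschitz
    refine isClosed_of_closure_subset fun s hs ↦ ?_
    have hsI : s ∈ Icc ε 1 := closure_minimal inter_subset_right isClosed_Icc hs
    refine ⟨EMetric.tendsto_nhds.2 fun η hη ↦ ?_, hsI⟩
    obtain ⟨δ, hδ, h⟩ := exists_forall_eventually_edist_lt hσ hV hsub hcd hη
    obtain ⟨r, hr, hrs⟩ := Metric.mem_closure_iff.1 hs δ hδ
    filter_upwards [h r hr.2 hr.1] with i hi
    rw [edist_comm]
    exact hi s hsI hrs.le
  · -- convergence to `c` propagates to the right of `s`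
    rintro s ⟨hs, hsε⟩
    have hs0 : 0 < s := hε0.trans_le hsε.1
    obtain ⟨δ, hδ, hδlim⟩ :=
      exists_forall_exists_tendsto hσ hV ⟨hs0.le, hsε.2.le⟩ hs
    set d := min δ (min s (1 - s)) with hd
    have hd0 : 0 < d := lt_min hδ (lt_min hs0 (sub_pos.2 hsε.2))
    have hds : d ≤ s := (min_le_right _ _).trans (min_le_left _ _)
    have hds' : d ≤ 1 - s := (min_le_right _ _).trans (min_le_right _ _)
    have hdsub : Icc (s - d) (s + d) ⊆ Icc (0 : ℝ) 1 := fun r hr ↦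
      ⟨by linarith [hr.1], by linarith [hr.2]⟩
    have hlim : ∀ r ∈ Icc (s - d) (s + d), ∃ x, Tendsto (fun i ↦ σ i r) U (𝓝 x) := fun r hr ↦
      hδlim r (hdsub hr) (le_trans (abs_le.2 ⟨by linarith [hr.1], by linarith [hr.2]⟩)
        (min_le_left _ _))
    have : Nonempty M := ⟨p⟩
    choose! τ hτ using hlim
    -- the limit `τ` of the `σ i` around `s` is a minimizing geodesic of speed `v`
    have hlt : s - d < s + d := by linarith
    have hτm : IsMinimizingGeodesic n τ (s - d) (s + d) :=
      .of_tendsto hlt (hσ.mono fun i hi ↦ hi.1.mono hlt (by linarith) (by linarith)) hτ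
    have hl := left_mem_Icc.2 hlt.le
    have hr := right_mem_Icc.2 hlt.le
    have hτv : HasSpeed n τ (s - d) (s + d) v := hτm.hasSpeed_of_edist_eq hv0 (by
      rw [edist_eq_of_tendsto hσ hV (hdsub hl) (hdsub hr) (hτ _ hl) (hτ _ hr),
        abs_of_nonneg (sub_nonneg.2 hlt.le)])
    have hsd : s ∈ Icc (s - d) (s + d) := ⟨by linarith, by linarith⟩
    have heq : τ s = c s := tendsto_nhds_unique (hτ s hsd) hs
    have hst : chartState (n := n) (τ s) τ (s - d) (s + d) s = chartState (τ s) c ε 1 s := by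
      refine chartState_eq_of_edist_ge hτm.isGeodesicSegment hc.isGeodesicSegment hτv hcv
        ⟨by linarith, by linarith⟩ hsε (mem_extChartAt_source _) heq ?_
      filter_upwards [Ioo_mem_nhdsGT hd0] with h hh
      have hsh : s - h ∈ Icc (s - d) (s + d) := ⟨by linarith [hh.2], by linarith [hh.1]⟩
      have hsh' : s + h ∈ Icc ε 1 := ⟨by linarith [hh.1, hsε.1], by linarith [hh.2]⟩
      have k1 := edist_eq_of_tendsto hσ hV h0 (hdsub hsh) hp (hτ _ hsh)
      have k2 := hc.edist_eq hcv hsh' (right_mem_Icc.2 hε1.le)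
      have k3 := edist_eq_of_tendsto hσ hV h0 h1 hp hq
      -- `v ≤ v * (s - h) + edist (τ (s - h)) (c (s + h)) + v * (1 - (s + h))`
      have k4 := edist_triangle4 p (τ (s - h)) (c (s + h)) q
      rw [hc1] at k2
      rw [sub_zero, abs_of_nonneg (hdsub hsh).1] at k1
      rw [abs_of_nonneg (sub_nonneg.2 hsh'.2)] at k2
      rw [sub_zero, abs_one] at k3
      rw [k1, k2, k3] at k4
      have k5 : v * 1 = v * (s - h) + 2 * v * h + v * (1 - (s + h)) := by ring
      have n1 : 0 ≤ v * (s - h) := mul_nonneg hv0 (hdsub hsh).1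
      have n2 : 0 ≤ 2 * v * h := mul_nonneg (by positivity) hh.1.le
      rw [k5, ENNReal.ofReal_add (add_nonneg n1 n2) (mul_nonneg hv0 (sub_nonneg.2 hsh'.2)),
        ENNReal.ofReal_add n1 n2] at k4
      exact ENNReal.le_of_add_le_add_left ENNReal.ofReal_ne_top
        (ENNReal.le_of_add_le_add_right ENNReal.ofReal_ne_top k4)
    filter_upwards [eventually_eq_of_chartState_eq hτm.isGeodesicSegment hc.isGeodesicSegment
      ⟨by linarith, by linarith⟩ hsε (mem_extChartAt_source _) heq hst,
      Ioo_mem_nhdsGT (by linarith : s < s + d)] with r hre hrI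
    rw [← hre]
    exact hτ r ⟨by linarith [hrI.1], hrI.2.le⟩

/-- The points `σ k (s k)` have the same limit along an ultrafilter as `σ k t`, where `t` is the
limit of `s k`, because the speeds are bounded. -/
lemma IsConvexManifold.isMinimallyPseudoconvex (hM : IsConvexManifold n M) :
    IsMinimallyPseudoconvex n M := by
  refine isMinimallyPseudoconvex_of_forall_mapClusterPt fun p q t σ s hσ hp hq hs ht hst ↦ ?_
  have hU : (hyperfilter ℕ : Filter ℕ) ≤ atTop := Nat.hyperfilter_le_atTop
  have hσU := Eventually.of_forall (f := (hyperfilter ℕ : Filter ℕ)) hσ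
  obtain ⟨x, hx⟩ := hM.exists_tendsto hσU (hp.mono_left hU) (hq.mono_left hU) ht
  refine ⟨x, (tendsto_of_edist_tendsto_zero ?_ hx).mapClusterPt.mono hU⟩
  have hV := tendsto_speed hσU (hp.mono_left hU) (hq.mono_left hU)
  have h := ENNReal.tendsto_ofReal (hV.mul ((tendsto_const_nhds (x := t)).sub
    (hst.mono_left hU)).abs)
  rw [sub_self, abs_zero, mul_zero, ENNReal.ofReal_zero] at h
  exact h.congr fun k ↦ ((hσ k).edist_eq (hσ k).hasSpeed (hs k) ht).symm

end

end

end RiemannianConvexity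

theorem mainTheorem4 (n : ℕ) (M : Type*) [EMetricSpace M]
    [ConnectedSpace M] [SecondCountableTopology M]
    [ChartedSpace (EuclideanSpace ℝ (Fin n)) M] [IsManifold (𝓡 n) ∞ M]
    [RiemannianBundle (fun x : M ↦ TangentSpace (𝓡 n) x)]
    [IsContMDiffRiemannianBundle (𝓡 n) ∞ (EuclideanSpace ℝ (Fin n))
      (fun x : M ↦ TangentSpace (𝓡 n) x)]
    [IsRiemannianManifold (𝓡 n) M] :
    (RiemannianConvexity.IsConvexManifold n M →
      RiemannianConvexity.HasMinimalLGS n M ∧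
        RiemannianConvexity.IsMinimallyPseudoconvex n M) ∧
    (RiemannianConvexity.HasMinimalLGS n M ↔
      RiemannianConvexity.IsMinimallyPseudoconvex n M) :=
  ⟨fun h ↦ ⟨h.isMinimallyPseudoconvex.hasMinimalLGS, h.isMinimallyPseudoconvex⟩,
    fun h ↦ h.isMinimallyPseudoconvex, fun h ↦ h.hasMinimalLGS⟩
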